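/- **Model.** Let $V$ be a finite non-empty set of colors with a (pseudo)metric $w$ (distinct colors at distance $0$ are allowed). A packet is a triple $(r,d,c)$ of arrival time $r\in\mathbb N_+$, deadline $d\in\mathbb N_+$ and color $c\in V$; its laxity is $d-r$. For a finite sequence $\sigma$ of packets (listed by arrival time), a feasible schedule assigns to every time-slot either the transmission of a packet, a color transition, or idling, such that every packet is transmitted at most once, a packet $(r,d,c)$ is transmitted only in slots $t$ with $r\le t\le d$, and between two successive transmissions, of colors $j$ and $k$, at least $w(j,k)$ slots are color-transition slots. $\mathrm{OPT}(\sigma)$ is the maximal number of packets transmitted by a feasible schedule. A deterministic online algorithm assigns to every $\sigma$ a feasible schedule whose action in slot $t$ depends only on the packets with $r\le t$; a randomized online algorithm is a random deterministic one (chosen independently of $\sigma$, each action being measurable). $\mathrm{ALG}(\sigma)$ is the number, respectively the expected number, of transmitted packets. For an integer $L\ge 1$, an algorithm achieves the competitive ratio $\rho$ for minimal laxity $L$ if $\mathrm{ALG}(\sigma)\ge\rho\cdot\mathrm{OPT}(\sigma)$ for every sequence $\sigma$ whose minimal laxity $\min_i (d_i-r_i)$ equals $L$. Let $\mathrm{MST}(G)$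 be the weight of a minimum spanning tree of the complete graph $G$ on $V$ with edge weights $w$, and $\delta=\mathrm{MST}(G)/L$. **Theorem.** There are absolute constants $c>0$ and $\alpha<1$ such that for every such space $G=(V,w)$ and every integer $L\ge 1$: * if $\delta<1$, then every ratio $\rho$ achieved by a deterministic or randomized online algorithm on $G$ for minimal laxity $L$ satisfies $\rho\le 1-c\sqrt{\delta}$; * if $\delta\ge 1$, then every ratio $\rho$ achieved by a deterministic or randomized online algorithm on $G$ for minimal laxity $L$ satisfies $\rho\le\alpha$. -/

import Mathlib

noncomputable section

namespace ColoredPackets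

/-- A packet `(r, d, c)`: arrival time `r ≥ 1`, deadline `d ≥ 1` and color `c`. -/
structure Packet (V : Type*) where
  arrival : ℕ
  deadline : ℕ
  color : V
  arrival_pos : 0 < arrival
  deadline_pos : 0 < deadline

/-- The laxity `d - r` of a packet. -/
def Packet.laxity {V : Type*} (p : Packet V) : ℤ := (p.deadline : ℤ) - (p.arrival : ℤ)

/-- A finite online sequence of packets, listed in order of arrival. Packets are identified by
their position in the list, so the same triple may occur many times. -/
structure PacketSequence (V : Type*) where
  packets : List (Packet V)
  sorted : packets.Pairwise (fun p q => p.arrival ≤ q.arrival)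

/-- `L` is the minimal laxity of the packets of `σ` (in particular `σ` is not empty). -/
def PacketSequence.HasMinLaxity {V : Type*} (σ : PacketSequence V) (L : ℕ) : Prop :=
  IsLeast {x : ℤ | ∃ p ∈ σ.packets, p.laxity = x} (L : ℤ)

/-- What happens in a time-slot: the `i`-th packet is transmitted, the slot is dedicated to a
color transition, or the slot is idle. -/
inductive Action where
  | transmit (i : ℕ)
  | transition
  | idle
  deriving DecidableEq

instance : MeasurableSpace Action := ⊤

/-- A schedule assigns an action to every time-slot. -/
abbrev Schedule : Type := ℕ → Action

/-- Feasible schedules for the sequence `σ`, the transition costs being the distances of the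
colors. -/
structure Feasible {V : Type*} [PseudoMetricSpace V] (σ : PacketSequence V) (S : Schedule) :
    Prop where
  /-- Only packets of the sequence are transmitted, between their arrival and their deadline. -/
  window : ∀ t i, S t = Action.transmit i →
    ∃ h : i < σ.packets.length,
      (σ.packets[i]'h).arrival ≤ t ∧ t ≤ (σ.packets[i]'h).deadline
  /-- A packet is transmitted at most once. -/
  once : ∀ i t t', S t = Action.transmit i → S t' = Action.transmit i → t = t'
  /-- Between two successive transmissions, of colors `j` and `k`, at least `dist j k` time-slots
  are dedicated to color transition. -/
  switch : ∀ (i j : ℕ) (hi : i < σ.packets.length) (hj : j < σ.packets.length) (t t' : ℕ),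
    t < t' → S t = Action.transmit i → S t' = Action.transmit j →
    (∀ s, t < s → s < t' → ∀ k, S s ≠ Action.transmit k) →
    dist (σ.packets[i]'hi).color (σ.packets[j]'hj).color ≤
      (((Finset.Ioo t t').filter (fun s => S s = Action.transition)).card : ℝ)

/-- The number of packets of `σ` that `S` transmits. -/
def throughput {V : Type*} (σ : PacketSequence V) (S : Schedule) : ℕ :=
  Set.ncard {i : ℕ | i < σ.packets.length ∧ ∃ t, S t = Action.transmit i}

/-- The optimal (offline) throughput. -/
def opt {V : Type*} [PseudoMetricSpace V] (σ : PacketSequence V) : ℕ :=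
  sSup {n : ℕ | ∃ S : Schedule, Feasible σ S ∧ throughput σ S = n}

theorem opt_isGreatest {V : Type*} [PseudoMetricSpace V] (σ : PacketSequence V) :
    IsGreatest {n : ℕ | ∃ S : Schedule, Feasible σ S ∧ throughput σ S = n} (opt σ) := by
  have hb : BddAbove {n : ℕ | ∃ S : Schedule, Feasible σ S ∧ throughput σ S = n} := by
    refine ⟨σ.packets.length, ?_⟩
    rintro n ⟨S, -, rfl⟩
    have h := Set.ncard_le_ncard (s := {i : ℕ | i < σ.packets.length ∧
      ∃ t, S t = Action.transmit i}) (t := Set.Iio σ.packets.length)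
      (fun i hi => hi.1) (Set.finite_Iio _)
    simpa [throughput, Set.ncard_eq_toFinset_card'] using h
  have hne : {n : ℕ | ∃ S : Schedule, Feasible σ S ∧ throughput σ S = n}.Nonempty :=
    ⟨_, fun _ => Action.idle, ⟨by simp, by simp, by simp⟩, rfl⟩
  exact ⟨Nat.sSup_mem hne hb, fun n hn => le_csSup hb hn⟩

/-- A deterministic online algorithm: it produces a feasible schedule for every sequence, and its
action in time-slot `t` depends only on the packets that have arrived up to time `t`. -/
structure OnlineAlgorithm (V : Type*) [PseudoMetricSpace V] where
  schedule : PacketSequence V → Schedule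
  feasible : ∀ σ, Feasible σ (schedule σ)
  causal : ∀ (σ τ : PacketSequence V) (t : ℕ),
    σ.packets.filter (fun p => decide (p.arrival ≤ t)) =
      τ.packets.filter (fun p => decide (p.arrival ≤ t)) →
    schedule σ t = schedule τ t

/-- A randomized online algorithm with probability space `Ω`: a random deterministic online
algorithm, the action in each time-slot being a random variable. -/
structure RandomizedOnlineAlgorithm (V : Type*) [PseudoMetricSpace V]
    (Ω : Type*) [MeasurableSpace Ω] where
  prob : MeasureTheory.Measure Ω
  isProbabilityMeasure : MeasureTheory.IsProbabilityMeasure prob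
  alg : Ω → OnlineAlgorithm V
  measurable_action : ∀ (σ : PacketSequence V) (t : ℕ),
    Measurable (fun ω => (alg ω).schedule σ t)

/-- The throughput of a deterministic online algorithm on `σ`. -/
def OnlineAlgorithm.value {V : Type*} [PseudoMetricSpace V] (A : OnlineAlgorithm V)
    (σ : PacketSequence V) : ℝ :=
  (throughput σ (A.schedule σ) : ℝ)

/-- The expected throughput of a randomized online algorithm on `σ`. -/
def RandomizedOnlineAlgorithm.value {V : Type*} [PseudoMetricSpace V]
    {Ω : Type*} [MeasurableSpace Ω] (R : RandomizedOnlineAlgorithm V Ω)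
    (σ : PacketSequence V) : ℝ :=
  MeasureTheory.integral R.prob (fun ω => (R.alg ω).value σ)

/-- An algorithm with (expected) throughput `ALG` achieves the competitive ratio `ρ` on the
sequences of minimal laxity `L`. -/
def AchievesRatio {V : Type*} [PseudoMetricSpace V] (ALG : PacketSequence V → ℝ) (L : ℕ)
    (ρ : ℝ) : Prop :=
  ∀ σ : PacketSequence V, σ.HasMinLaxity L → ρ * (opt σ : ℝ) ≤ ALG σ

open scoped Classical in
/-- The total weight of the edges of a graph on the points of a finite (pseudo)metric space. -/
def graphWeight {V : Type*} [Fintype V] [PseudoMetricSpace V] (T : SimpleGraph V) : ℝ :=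
  ∑ e ∈ T.edgeFinset, Sym2.lift ⟨fun x y : V => dist x y, fun x y => dist_comm x y⟩ e

/-- The weight of a minimum spanning tree of the complete graph on `V`, edges being weighted by
the distance. -/
def mst (V : Type*) [Fintype V] [PseudoMetricSpace V] : ℝ :=
  sInf {x : ℝ | ∃ T : SimpleGraph V, T.IsTree ∧ graphWeight T = x}

theorem mst_isLeast (V : Type*) [Fintype V] [Nonempty V] [PseudoMetricSpace V] :
    IsLeast {x : ℝ | ∃ T : SimpleGraph V, T.IsTree ∧ graphWeight T = x} (mst V) := by
  have hfin : {x : ℝ | ∃ T : SimpleGraph V, T.IsTree ∧ graphWeight T = x}.Finite :=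
    (Set.toFinite {T : SimpleGraph V | T.IsTree}).image graphWeight
  have hne : {x : ℝ | ∃ T : SimpleGraph V, T.IsTree ∧ graphWeight T = x}.Nonempty := by
    obtain ⟨T, -, hT⟩ := (SimpleGraph.connected_top (V := V)).exists_isTree_le
    exact ⟨_, T, hT, rfl⟩
  exact ⟨hne.csInf_mem hfin, fun x hx => csInf_le hfin.bddBelow hx⟩

/-- The parameter `δ = MST(G) / L`. -/
def delta (V : Type*) [Fintype V] [PseudoMetricSpace V] (L : ℕ) : ℝ := mst V / (L : ℝ)

end ColoredPackets

end

universe u v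

/-! By averaging (`ratio_le_of_family`), it suffices to exhibit finitely many sequences on which
every deterministic algorithm falls short of the optimum by a fixed proportion in total. Integrating
over the random choice then covers randomized algorithms.

If two colors have a gap of order `L`, the adversary offers `L + 1` urgent packets of each color and
then continues with only one of them. The algorithm must commit to a color or pay for a transition,
so it loses a constant fraction (`ratio_le_of_gap`).

If all gaps are small, some set `W` of colors has connection cost `M` of order `min (MST, L)`, up to
a small constant factor (`exists_spanCost_between`). Time is cut into `2κ` periods with `κ ≈ √(L /
M)`. Each period opens with a batch of `2κM` packets, colored so that serving all but few of them
within the period requires about `M` transitions: `κ * waste + pending ≥ κM`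
(`exists_spans_of_feasible`, `exists_batch`). After an unpredictable number of batches comes a flood
of `L + 1` urgent packets, which fills every slot in which the pending packets of the last batch
could still be sent. Hence serving batches at once costs waste in all later scenarios, and
postponing costs the pending packets in the scenario that stops now. On average the loss is at least
`κM / 4` (`FloodGame.sum_throughput_le`).

An offline schedule knows the moment of the flood. It serves many batches in one tour and makes the
last tour just before the flood, at a loss of at most `κM / 8` (`FloodGame.le_opt_seq`). The net
loss of order `κM` out of `O(L)` packets is a proportion of order `√(M / L)`, that is `min (1, √δ)`.
-/

noncomputable section

namespace ColoredPackets

variable {V : Type*}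

/-! ### Cost of connecting sets of colors, with distances rounded up -/

section Spans

variable [PseudoMetricSpace V]

/-- The number of transition slots needed between two colors. -/
def gap (u v : V) : ℕ := ⌈dist u v⌉₊

theorem gap_self (u : V) : gap u u = 0 := by simp [gap]

theorem gap_comm (u v : V) : gap u v = gap v u := by simp [gap, dist_comm]

theorem dist_le_gap (u v : V) : dist u v ≤ gap u v := Nat.le_ceil _

theorem gap_triangle (u v z : V) : gap u z ≤ gap u v + gap v z := by
  refine Nat.ceil_le.2 ?_
  push_cast
  linarith [dist_triangle u v z, dist_le_gap u v, dist_le_gap v z]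

theorem graphWeight_mono [Fintype V] {G H : SimpleGraph V} (h : G ≤ H) :
    graphWeight G ≤ graphWeight H := by
  classical
  unfold graphWeight
  refine Finset.sum_le_sum_of_subset_of_nonneg (SimpleGraph.edgeFinset_mono h) fun e _ _ => ?_
  induction e with | _ a b => exact dist_nonneg

theorem graphWeight_sup_edge_le [Fintype V] (G : SimpleGraph V) (u v : V) :
    graphWeight (G ⊔ SimpleGraph.edge u v) ≤ graphWeight G + dist u v := by
  classical
  have hsub : (G ⊔ SimpleGraph.edge u v).edgeFinset ⊆ insert s(u, v) G.edgeFinset := by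
    intro e he
    rw [SimpleGraph.mem_edgeFinset] at he
    induction e with | _ a b => ?_
    rw [SimpleGraph.mem_edgeSet, SimpleGraph.sup_adj, SimpleGraph.edge_adj] at he
    rw [Finset.mem_insert, SimpleGraph.mem_edgeFinset, SimpleGraph.mem_edgeSet, Sym2.eq_iff]
    tauto
  unfold graphWeight
  refine (Finset.sum_le_sum_of_subset_of_nonneg (s := _) (t := insert s(u, v) G.edgeFinset)
    (fun e he => hsub (by simpa using he)) fun e _ _ => ?_).trans ?_
  · induction e with | _ a b => exact dist_nonneg
  · by_cases h : s(u, v) ∈ G.edgeFinset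
    · rw [Finset.insert_eq_of_mem h]
      exact le_add_of_nonneg_right dist_nonneg
    · rw [Finset.sum_insert h, add_comm]
      refine le_of_eq ?_
      simp only [Sym2.lift_mk]

variable [DecidableEq V]

/-- `Spans s k`: the points of `s` can be connected one after the other at total cost `k`. -/
inductive Spans : Finset V → ℕ → Prop
  | single (v : V) : Spans {v} 0
  | attach {s : Finset V} {k : ℕ} {u v : V} :
      Spans s k → u ∈ s → v ∉ s → Spans (insert v s) (k + gap u v)

theorem Spans.gap_le {s : Finset V} {k : ℕ} (h : Spans s k) :
    ∀ u ∈ s, ∀ v ∈ s, gap u v ≤ k := by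
  induction h with
  | single v => simp [gap_self]
  | @attach s k a b _ ha hb ih =>
    have key : ∀ y ∈ s, gap y b ≤ k + gap a b := fun y hy =>
      (gap_triangle y a b).trans (Nat.add_le_add_right (ih y hy a ha) _)
    intro u hu v hv
    rcases Finset.mem_insert.1 hu with rfl | hu' <;> rcases Finset.mem_insert.1 hv with rfl | hv'
    · simp [gap_self]
    · rw [gap_comm]; exact key v hv'
    · exact key u hu'
    · exact (ih u hu' v hv').trans (Nat.le_add_right _ _)

/-- Used with `D = 0`: a positive span cost forces some gap to be positive. -/
theorem Spans.le_card_mul {D : ℕ} (hD : ∀ u v : V, gap u v ≤ D) {s : Finset V} {k : ℕ}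
    (h : Spans s k) : k ≤ s.card * D := by
  induction h with
  | single v => exact Nat.zero_le _
  | @attach s k a b _ ha hb ih =>
    rw [Finset.card_insert_of_notMem hb, Nat.succ_mul]
    exact Nat.add_le_add ih (hD a b)

theorem exists_spans (s : Finset V) (hs : s.Nonempty) : ∃ k, Spans s k := by
  induction hs using Finset.Nonempty.cons_induction with
  | singleton a => exact ⟨0, .single a⟩
  | cons a s ha hs ih =>
    obtain ⟨k, hk⟩ := ih
    obtain ⟨u, hu⟩ := hs
    rw [Finset.cons_eq_insert]
    exact ⟨_, .attach hk hu ha⟩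

/-- A spanning structure distributes its cost over its points so that the points outside of a
connected set containing the root can be connected to this set at their own cost. -/
theorem Spans.exists_charge {s : Finset V} {k : ℕ} (h : Spans s k) :
    ∃ r ∈ s, ∃ e : V → ℕ, ∑ v ∈ s, e v = k ∧
      ∀ t l, Spans t l → r ∈ t → Spans (t ∪ s) (l + ∑ v ∈ s \ t, e v) := by
  induction h with
  | single v =>
    refine ⟨v, by simp, fun _ => 0, by simp, fun t l ht hv => ?_⟩
    have : t ∪ {v} = t := Finset.union_eq_left.2 (by simpa using hv)
    simpa [this] using ht
  | @attach s k a b _ ha hb ih =>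
    obtain ⟨r, hr, e, he, hext⟩ := ih
    have hne : ∀ v ∈ s, Function.update e b (gap a b) v = e v := fun v hv =>
      Function.update_of_ne (ne_of_mem_of_not_mem hv hb) _ _
    -- Each point other than the root is charged with the edge that attached it. Its parent is
    -- present when it is attached again, and the edge is saved if the point already lies in `t`.
    refine ⟨r, Finset.mem_insert_of_mem hr, Function.update e b (gap a b), ?_, ?_⟩
    · rw [Finset.sum_insert hb, Function.update_self, Finset.sum_congr rfl hne, he, add_comm]
    · intro t l ht hrt
      have hsum : ∑ v ∈ s \ t, Function.update e b (gap a b) v = ∑ v ∈ s \ t, e v :=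
        Finset.sum_congr rfl fun v hv => hne v (Finset.mem_sdiff.1 hv).1
      have h1 := hext t l ht hrt
      by_cases hbt : b ∈ t
      · rw [Finset.insert_sdiff_of_mem _ hbt, hsum, Finset.union_insert,
          Finset.insert_eq_of_mem (Finset.mem_union_left _ hbt)]
        exact h1
      · rw [Finset.insert_sdiff_of_notMem _ hbt, Finset.sum_insert (by simp [hb]),
          Function.update_self, hsum, Finset.union_insert, add_comm (gap a b), ← add_assoc]
        exact .attach h1 (Finset.mem_union_right _ ha) (by simp [hb, hbt])

/-- A spanned set can be laid out on a line of twice the cost without contracting distances. -/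
theorem Spans.exists_layout {s : Finset V} {k : ℕ} (h : Spans s k) :
    ∃ x : V → ℕ, (∀ v ∈ s, x v ≤ 2 * k) ∧
      ∀ u ∈ s, ∀ v ∈ s, x u ≤ x v → x u + gap u v ≤ x v := by
  induction h with
  | single v => exact ⟨fun _ => 0, by simp, by simp [gap_self]⟩
  | @attach s k a b _ ha hb ih =>
    obtain ⟨x, hx, hgap⟩ := ih
    -- The new point is placed at distance `gap a b` to the right of `a`, and everything beyond `a`
    -- is shifted by `2 * gap a b`. This is the detour to `b` and back in a walk around the tree.
    let y : V → ℕ := fun v =>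
      if v = b then x a + gap a b else if x v ≤ x a then x v else x v + 2 * gap a b
    have hyb : y b = x a + gap a b := by simp [y]
    have hy : ∀ v ∈ s, y v = if x v ≤ x a then x v else x v + 2 * gap a b := fun v hv => by
      have : v ≠ b := fun h => hb (h ▸ hv)
      simp [y, this]
    refine ⟨y, ?_, ?_⟩
    · intro v hv
      rcases Finset.mem_insert.1 hv with rfl | hv
      · have := hx a ha; omega
      · rw [hy v hv]; have := hx v hv; split_ifs <;> omega
    · intro u hu v hv huv
      rcases Finset.mem_insert.1 hu with rfl | hu' <;> rcases Finset.mem_insert.1 hv with rfl | hv'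
      · simp [gap_self]
      · rw [hyb] at huv ⊢
        rw [hy v hv'] at huv ⊢
        have h1 := gap_triangle u a v
        rw [gap_comm u a] at h1
        split_ifs at huv ⊢ with hc
        · have := hgap v hv' a ha hc
          have h2 := gap_comm a v
          omega
        · have := hgap a ha v hv' (by omega)
          omega
      · rw [hyb] at huv ⊢
        rw [hy u hu'] at huv ⊢
        have h1 := gap_triangle u a v
        split_ifs at huv ⊢ with hc
        · have := hgap u hu' a ha hc
          omega
        · omega
      · rw [hy u hu', hy v hv'] at huv ⊢
        split_ifs at huv ⊢ with h1 h2 h2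
        · exact hgap u hu' v hv' huv
        · have := hgap u hu' v hv' (by omega); omega
        · have := hgap v hv' u hu' (by omega); omega
        · have := hgap u hu' v hv' (by omega); omega

theorem Spans.exists_graph [Fintype V] {s : Finset V} {k : ℕ} (h : Spans s k) :
    ∃ G : SimpleGraph V, (∀ u ∈ s, ∀ v ∈ s, G.Reachable u v) ∧ graphWeight G ≤ k := by
  induction h with
  | single v =>
    refine ⟨⊥, by simp, ?_⟩
    simp only [graphWeight, Nat.cast_zero]
    refine (Finset.sum_eq_zero fun e he => ?_).le
    simp at he
  | @attach s k a b _ ha hb ih =>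
    obtain ⟨G, hG, hk⟩ := ih
    refine ⟨G ⊔ SimpleGraph.edge a b, ?_, ?_⟩
    · have hab : (G ⊔ SimpleGraph.edge a b).Reachable a b := by
        refine SimpleGraph.Adj.reachable ?_
        rw [SimpleGraph.sup_adj, SimpleGraph.edge_adj]
        exact Or.inr ⟨Or.inl ⟨rfl, rfl⟩, fun h => hb (h ▸ ha)⟩
      have key : ∀ u ∈ insert b s, (G ⊔ SimpleGraph.edge a b).Reachable a u := by
        intro u hu
        rcases Finset.mem_insert.1 hu with rfl | hu
        · exact hab
        · exact (hG a ha u hu).mono le_sup_left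
      exact fun u hu v hv => (key u hu).symm.trans (key v hv)
    · have := graphWeight_sup_edge_le G a b
      have := dist_le_gap a b
      push_cast
      linarith

/-- Rounding distances up only increases the cost. This is the direction needed to turn a loss
measured by span costs into one measured by `mst V`. -/
theorem mst_le_of_spans [Fintype V] [Nonempty V] {k : ℕ} (h : Spans (Finset.univ : Finset V) k) :
    mst V ≤ k := by
  obtain ⟨G, hG, hk⟩ := h.exists_graph
  have hc : G.Connected := ⟨fun u v => hG u (Finset.mem_univ _) v (Finset.mem_univ _)⟩
  obtain ⟨T, hTG, hT⟩ := hc.exists_isTree_le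
  exact ((mst_isLeast V).2 ⟨T, hT, rfl⟩).trans ((graphWeight_mono hTG).trans hk)

/-- The least cost of connecting the points of a set. -/
def spanCost (s : Finset V) : ℕ := sInf {k | Spans s k}

theorem spans_spanCost {s : Finset V} (hs : s.Nonempty) : Spans s (spanCost s) :=
  Nat.sInf_mem (exists_spans s hs)

theorem spanCost_le {s : Finset V} {k : ℕ} (h : Spans s k) : spanCost s ≤ k := Nat.sInf_le h

/-- If all gaps are small, then some set has a span cost of prescribed order of magnitude. -/
theorem exists_spanCost_between {D θ : ℕ} (hD : ∀ u v : V, gap u v ≤ D) {s : Finset V}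
    (hs : s.Nonempty) :
    ∃ t : Finset V, t.Nonempty ∧ min (spanCost s) θ ≤ spanCost t ∧ spanCost t ≤ θ + D := by
  induction hs using Finset.Nonempty.cons_induction with
  | singleton a =>
    refine ⟨{a}, by simp, min_le_left _ _, ?_⟩
    exact (spanCost_le (.single a)).trans (Nat.zero_le _)
  | cons a s ha hs ih =>
    -- A discrete intermediate value argument: adding a point raises the cost by at most `D`, so the
    -- first set to exceed `θ` will do. Monotonicity of `spanCost`, which fails because extra points
    -- may serve as Steiner points, is not needed.
    by_cases h : spanCost s ≤ θ
    · refine ⟨Finset.cons a s ha, by simp, min_le_left _ _, ?_⟩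
      obtain ⟨u, hu⟩ := hs
      rw [Finset.cons_eq_insert]
      exact (spanCost_le (.attach (spans_spanCost ⟨u, hu⟩) hu ha)).trans
        (add_le_add h (hD u a))
    · obtain ⟨t, ht, h1, h2⟩ := ih
      exact ⟨t, ht, by omega, h2⟩

end Spans

/-! ### Counting transmissions, wasted slots and lost packets -/

section Sequences

/-- The sequence of the first `n` packets of an infinite sequence. -/
def seqOf (p : ℕ → Packet V) (hp : Monotone fun i => (p i).arrival) (n : ℕ) : PacketSequence V where
  packets := (List.range n).map p
  sorted := by
    rw [List.pairwise_map]
    exact List.pairwise_lt_range.imp fun h => hp h.le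

variable {p p' : ℕ → Packet V} {hp : Monotone fun i => (p i).arrival}
  {hp' : Monotone fun i => (p' i).arrival} {n n' : ℕ}

@[simp] theorem length_seqOf : (seqOf p hp n).packets.length = n := by simp [seqOf]

@[simp] theorem getElem_seqOf {i : ℕ} (h : i < (seqOf p hp n).packets.length) :
    (seqOf p hp n).packets[i] = p i := by simp [seqOf]

theorem filter_seqOf {a t : ℕ} (ha : a ≤ n) (h : ∀ i, a ≤ i → t < (p i).arrival) :
    (seqOf p hp n).packets.filter (fun q => decide (q.arrival ≤ t)) =
      ((List.range a).map p).filter (fun q => decide (q.arrival ≤ t)) := by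
  obtain ⟨b, rfl⟩ := Nat.exists_eq_add_of_le ha
  simp only [seqOf, List.range_add, List.map_append, List.filter_append, List.append_right_eq_self,
    List.filter_eq_nil_iff, List.mem_map]
  rintro q ⟨i, ⟨j, -, rfl⟩, rfl⟩
  simpa using h _ (Nat.le_add_right _ _)

/-- Causality for sequences with a common prefix: nothing beyond the first `a` packets has arrived
by time `t`. -/
theorem schedule_eq_of_prefix [PseudoMetricSpace V] (A : OnlineAlgorithm V) {a t : ℕ}
    (hn : a ≤ n) (hn' : a ≤ n') (heq : ∀ i < a, p i = p' i)
    (h : ∀ i, a ≤ i → t < (p i).arrival) (h' : ∀ i, a ≤ i → t < (p' i).arrival) :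
    A.schedule (seqOf p hp n) t = A.schedule (seqOf p' hp' n') t := by
  refine A.causal _ _ _ ?_
  rw [filter_seqOf hn h, filter_seqOf hn' h']
  congr 1
  exact List.map_congr_left fun i hi => heq i (List.mem_range.1 hi)

theorem hasMinLaxity_seqOf {L : ℕ} (h : ∀ i < n, (p i).arrival + L ≤ (p i).deadline)
    (h' : ∃ i < n, (p i).arrival + L = (p i).deadline) : (seqOf p hp n).HasMinLaxity L := by
  constructor
  · obtain ⟨i, hi, h⟩ := h'
    refine ⟨p i, by simpa [seqOf] using ⟨i, hi, rfl⟩, ?_⟩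
    simp only [Packet.laxity]; omega
  · rintro x ⟨q, hq, rfl⟩
    obtain ⟨i, hi, rfl⟩ : ∃ i < n, p i = q := by simpa [seqOf] using hq
    have := h i hi
    simp only [Packet.laxity]; omega

variable [PseudoMetricSpace V]

/-- A lower bound of the optimal throughput: the packets `f t` are transmitted in the slots `t` of
`E`, and all other slots are transition slots. -/
theorem card_le_opt_seqOf (E : Finset ℕ) (f : ℕ → ℕ) (hf : ∀ t ∈ E, f t < n)
    (hwin : ∀ t ∈ E, (p (f t)).arrival ≤ t ∧ t ≤ (p (f t)).deadline)
    (hinj : Set.InjOn f E)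
    (hsep : ∀ t ∈ E, ∀ t' ∈ E, t < t' → gap (p (f t)).color (p (f t')).color + t < t') :
    E.card ≤ opt (seqOf p hp n) := by
  classical
  let S : Schedule := fun t => if t ∈ E then .transmit (f t) else .transition
  have hS : ∀ t i, S t = .transmit i ↔ t ∈ E ∧ f t = i := by
    intro t i
    by_cases h : t ∈ E <;> simp [S, h]
  have hfeas : Feasible (seqOf p hp n) S := by
    refine ⟨?_, ?_, ?_⟩
    · intro t i h
      obtain ⟨ht, rfl⟩ := (hS t i).1 h
      exact ⟨by simpa using hf t ht, by simpa using hwin t ht⟩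
    · intro i t t' h h'
      obtain ⟨ht, h⟩ := (hS t i).1 h
      obtain ⟨ht', h'⟩ := (hS t' i).1 h'
      exact hinj ht ht' (h.trans h'.symm)
    · intro i j hi hj t t' htt' h h' hbetween
      obtain ⟨ht, rfl⟩ := (hS t i).1 h
      obtain ⟨ht', rfl⟩ := (hS t' j).1 h'
      have hall : (Finset.Ioo t t').filter (fun s => S s = Action.transition) =
          Finset.Ioo t t' := by
        refine Finset.filter_true_of_mem fun s hs => ?_
        rw [Finset.mem_Ioo] at hs
        by_cases h : s ∈ E
        · exact absurd ((hS s (f s)).2 ⟨h, rfl⟩) (hbetween s hs.1 hs.2 _)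
        · simp [S, h]
      rw [hall, Nat.card_Ioo]
      simp only [getElem_seqOf]
      refine (dist_le_gap _ _).trans (Nat.cast_le.2 ?_)
      have := hsep t ht t' ht' htt'
      omega
  refine le_trans (le_of_eq ?_) ((opt_isGreatest _).2 ⟨S, hfeas, rfl⟩)
  rw [throughput, ← Finset.card_image_of_injOn hinj, ← Set.ncard_coe_finset]
  congr 1
  ext i
  simp only [Finset.coe_image, Set.mem_image, Finset.mem_coe, length_seqOf, Set.mem_ofPred_eq, hS]
  constructor
  · rintro ⟨t, ht, rfl⟩
    exact ⟨hf t ht, t, ht, rfl⟩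
  · rintro ⟨-, t, ht, rfl⟩
    exact ⟨t, ht, rfl⟩

open scoped Classical in
/-- The number of slots of `(a, b]` in which nothing is transmitted. -/
def waste (S : Schedule) (a b : ℕ) : ℕ :=
  ((Finset.Ioc a b).filter (fun t => ∀ i, S t ≠ .transmit i)).card

theorem waste_add (S : Schedule) {a b c : ℕ} (hab : a ≤ b) (hbc : b ≤ c) :
    waste S a c = waste S a b + waste S b c := by
  classical
  rw [waste, waste, waste, ← Finset.card_union_of_disjoint, ← Finset.filter_union,
    Finset.Ioc_union_Ioc_eq_Ioc hab hbc]
  refine Finset.disjoint_filter_filter (Finset.disjoint_left.2 fun x hx hx' => ?_)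
  simp only [Finset.mem_Ioc] at hx hx'
  omega

theorem waste_eq_sum (S : Schedule) (T m : ℕ) :
    waste S 0 (m * T) = ∑ k ∈ Finset.range m, waste S (k * T) ((k + 1) * T) := by
  induction m with
  | zero => simp [waste]
  | succ m ih =>
    rw [Finset.sum_range_succ, ← ih]
    exact waste_add S (Nat.zero_le _) (Nat.mul_le_mul_right _ (Nat.le_succ _))

theorem waste_congr {S S' : Schedule} {a b : ℕ} (h : ∀ t, a < t → t ≤ b → S t = S' t) :
    waste S a b = waste S' a b := by
  classical
  unfold waste
  congr 1
  refine Finset.filter_congr fun t ht => ?_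
  rw [Finset.mem_Ioc] at ht
  rw [h t ht.1 ht.2]

theorem waste_of_transmit {S : Schedule} {b : ℕ} {a i : ℕ} (hab : a ≤ b)
    (h : S (b + 1) = .transmit i) : waste S a (b + 1) = waste S a b := by
  classical
  rw [waste_add S hab (Nat.le_succ b), Nat.add_eq_left, waste, Finset.card_eq_zero,
    Finset.filter_eq_empty_iff]
  intro t ht h'
  obtain rfl : t = b + 1 := by rw [Finset.mem_Ioc] at ht; omega
  exact h' i h

theorem card_transition_le_waste (S : Schedule) (t t' : ℕ) :
    ((Finset.Ioo t (t' + 1)).filter (fun s => S s = Action.transition)).card ≤ waste S t t' := by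
  classical
  refine Finset.card_le_card fun s hs => ?_
  rw [Finset.mem_filter, Finset.mem_Ioo] at hs
  rw [Finset.mem_filter, Finset.mem_Ioc]
  exact ⟨by omega, by simp [hs.2]⟩

/-- The colors transmitted in an interval are connected at the cost of the wasted slots. -/
theorem exists_spans_of_feasible [DecidableEq V] {S : Schedule} (hS : Feasible (seqOf p hp n) S)
    {W : Finset V} (hW : ∀ i < n, (p i).color ∈ W) (a b : ℕ) :
    (∀ t, a < t → t ≤ b → ∀ i, S t ≠ .transmit i) ∨
      ∃ X ⊆ W, ∃ l ≤ waste S a b, Spans X l ∧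
        ∀ t, a < t → t ≤ b → ∀ i, S t = .transmit i → (p i).color ∈ X := by
  -- For the induction, `t₀` is the last transmission so far. The slots wasted after `t₀` are kept
  -- out of `l`, in reserve for the edge to the next color.
  suffices H : ∀ d, (∀ t, a < t → t ≤ a + d → ∀ i, S t ≠ .transmit i) ∨
      ∃ X ⊆ W, ∃ t₀ i₀ l, a < t₀ ∧ t₀ ≤ a + d ∧ S t₀ = .transmit i₀ ∧
        (∀ t, t₀ < t → t ≤ a + d → ∀ i, S t ≠ .transmit i) ∧
        l + waste S t₀ (a + d) ≤ waste S a (a + d) ∧ Spans X l ∧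
        ∀ t, a < t → t ≤ a + d → ∀ i, S t = .transmit i → (p i).color ∈ X by
    by_cases hab : a ≤ b
    · obtain ⟨d, rfl⟩ := Nat.exists_eq_add_of_le hab
      rcases H d with h | ⟨X, hX, t₀, i₀, l, h1, h2, h3, h4, h5, h6, h7⟩
      · exact Or.inl h
      · exact Or.inr ⟨X, hX, l, by omega, h6, h7⟩
    · exact Or.inl fun t h h' => absurd (h.trans_le h').le hab
  intro d
  induction d with
  | zero => exact Or.inl fun t h h' => by omega
  | succ d ih =>
    rw [← Nat.add_assoc]
    by_cases hd : ∃ i, S (a + d + 1) = .transmit i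
    · obtain ⟨i, hi⟩ := hd
      right
      have hlast : ∀ t, a + d + 1 < t → t ≤ a + d + 1 → ∀ i, S t ≠ .transmit i :=
        fun t h h' => by omega
      obtain ⟨hin, -⟩ := hS.window _ _ hi
      have hin' : i < n := by simpa using hin
      rcases ih with h | ⟨X, hX, t₀, i₀, l, h1, h2, h3, h4, h5, h6, h7⟩
      · refine ⟨{(p i).color}, by simpa using hW i hin', a + d + 1, i, 0, by omega, le_rfl, hi,
          hlast, by simp [waste], .single _, ?_⟩
        intro t ht ht' j hj
        rcases ht'.eq_or_lt with rfl | ht'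
        · obtain rfl : i = j := by simpa [hi] using hj
          simp
        · exact absurd hj (h t ht (by omega) j)
      · obtain ⟨hin0, -⟩ := hS.window _ _ h3
        have hsw := hS.switch i₀ i hin0 hin t₀ (a + d + 1) (by omega) h3 hi
          (fun s hs hs' k => h4 s hs (by omega) k)
        simp only [getElem_seqOf] at hsw
        have hgap : gap (p i₀).color (p i).color ≤ waste S t₀ (a + d) :=
          (Nat.ceil_le.2 hsw).trans (card_transition_le_waste S _ _)
        have hw := waste_of_transmit (a := a) (by omega) hi
        have hw0 : waste S (a + d + 1) (a + d + 1) = 0 := by simp [waste]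
        have hmem : ∀ t, a < t → t ≤ a + d + 1 → ∀ j, S t = .transmit j →
            (p j).color = (p i).color ∨ (p j).color ∈ X := by
          intro t ht ht' j hj
          rcases ht'.eq_or_lt with rfl | ht'
          · obtain rfl : i = j := by simpa [hi] using hj
            exact Or.inl rfl
          · exact Or.inr (h7 t ht (by omega) j hj)
        by_cases hiX : (p i).color ∈ X
        · refine ⟨X, hX, a + d + 1, i, l, by omega, le_rfl, hi, hlast, by omega, h6, ?_⟩
          intro t ht ht' j hj
          rcases hmem t ht ht' j hj with h | h
          · rwa [h]
          · exact h
        · refine ⟨insert (p i).color X, Finset.insert_subset (hW i hin') hX, a + d + 1, i,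
            l + gap (p i₀).color (p i).color, by omega, le_rfl, hi, hlast, by omega,
            .attach h6 (h7 t₀ h1 h2 _ h3) hiX, ?_⟩
          intro t ht ht' j hj
          exact Finset.mem_insert.2 (hmem t ht ht' j hj)
    · push Not at hd
      have hnot : ∀ t₀, (∀ t, t₀ < t → t ≤ a + d → ∀ i, S t ≠ .transmit i) →
          ∀ t, t₀ < t → t ≤ a + d + 1 → ∀ i, S t ≠ .transmit i := by
        intro t₀ h t ht ht' i
        rcases ht'.eq_or_lt with rfl | ht'
        · exact hd i
        · exact h t ht (by omega) i
      rcases ih with h | ⟨X, hX, t₀, i₀, l, h1, h2, h3, h4, h5, h6, h7⟩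
      · exact Or.inl (hnot a h)
      · refine Or.inr ⟨X, hX, t₀, i₀, l, h1, by omega, h3, hnot t₀ h4, ?_, h6, ?_⟩
        · rw [waste_add S h2 (Nat.le_succ _), waste_add S (a := a) (b := a + d) (by omega)
            (Nat.le_succ _)]
          omega
        · intro t ht ht' i hi
          rcases ht'.eq_or_lt with rfl | ht'
          · exact absurd hi (hd i)
          · exact h7 t ht (by omega) i hi

omit [PseudoMetricSpace V] in
theorem throughput_eq_card {S : Schedule} (T : Finset ℕ)
    (hT : ∀ i, i ∈ T ↔ i < n ∧ ∃ t, S t = .transmit i) :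
    throughput (seqOf p hp n) S = T.card := by
  rw [throughput, ← Set.ncard_coe_finset]
  congr 1
  ext i
  simp [hT]

omit [PseudoMetricSpace V] in
/-- The packets of `I` that are transmitted between `a` and `b` use up different slots. -/
theorem card_transmitted_le {S : Schedule} {a b : ℕ}
    (I : Finset ℕ) (hI : ∀ i ∈ I, ∃ t, a < t ∧ t ≤ b ∧ S t = .transmit i) :
    I.card + waste S a b ≤ b - a := by
  classical
  choose! g hg using hI
  have hinj : Set.InjOn g I := fun i hi j hj hij => by
    have h1 := (hg i hi).2.2
    rw [hij, (hg j hj).2.2] at h1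
    simpa using h1.symm
  rw [← Finset.card_image_of_injOn hinj, waste, ← Finset.card_union_of_disjoint, ← Nat.card_Ioc]
  · refine Finset.card_le_card (Finset.union_subset ?_ (Finset.filter_subset _ _))
    intro t ht
    obtain ⟨i, hi, rfl⟩ := Finset.mem_image.1 ht
    exact Finset.mem_Ioc.2 ⟨(hg i hi).1, (hg i hi).2.1⟩
  · refine Finset.disjoint_left.2 fun t ht ht' => ?_
    obtain ⟨i, hi, rfl⟩ := Finset.mem_image.1 ht
    exact (Finset.mem_filter.1 ht').2 i (hg i hi).2.2

/-- Wasted slots are lost. -/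
theorem throughput_add_waste_le {S : Schedule} (hS : Feasible (seqOf p hp n) S) {H : ℕ}
    (hH : ∀ i < n, (p i).deadline ≤ H) :
    throughput (seqOf p hp n) S + waste S 0 H ≤ H := by
  classical
  rw [throughput_eq_card ((Finset.range n).filter fun i => ∃ t, S t = .transmit i)
    (by simp)]
  refine card_transmitted_le _ fun i hi => ?_
  obtain ⟨hi, t, ht⟩ := Finset.mem_filter.1 hi
  obtain ⟨h, hw⟩ := hS.window t i ht
  simp only [getElem_seqOf] at hw
  have := (p i).arrival_pos
  have := hH i (Finset.mem_range.1 hi)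
  exact ⟨t, by omega, by omega, ht⟩

omit [PseudoMetricSpace V] in
/-- Packets that compete for the same slots are lost. -/
theorem throughput_add_card_le {S : Schedule} {a b : ℕ} (I : Finset ℕ) (hIn : ∀ i ∈ I, i < n)
    (hI : ∀ i ∈ I, ∀ t, S t = .transmit i → a < t ∧ t ≤ b) :
    throughput (seqOf p hp n) S + I.card ≤ n + (b - a) := by
  classical
  set T := (Finset.range n).filter fun i => ∃ t, S t = .transmit i with hTdef
  rw [throughput_eq_card T (by simp [T])]
  have h1 : (T ∩ I).card + waste S a b ≤ b - a := by
    refine card_transmitted_le _ fun i hi => ?_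
    obtain ⟨hi, hi'⟩ := Finset.mem_inter.1 hi
    obtain ⟨-, t, ht⟩ := Finset.mem_filter.1 hi
    exact ⟨t, (hI i hi' t ht).1, (hI i hi' t ht).2, ht⟩
  have h2 : (T ∪ I).card ≤ n := by
    rw [← Finset.card_range n]
    refine Finset.card_le_card (Finset.union_subset (Finset.filter_subset _ _) ?_)
    exact fun i hi => Finset.mem_range.2 (hIn i hi)
  have := Finset.card_union_add_card_inter T I
  omega

end Sequences

/-! ### The averaging principle -/

section Ratio

variable [PseudoMetricSpace V]

open MeasureTheory

omit [PseudoMetricSpace V] in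
theorem throughput_eq_sum_indicator {Ω : Type*} (σ : PacketSequence V) (S : Ω → Schedule) (ω : Ω) :
    (throughput σ (S ω) : ℝ) = ∑ i ∈ Finset.range σ.packets.length,
      Set.indicator {ω | ∃ t, S ω t = .transmit i} 1 ω := by
  classical
  have : throughput σ (S ω) = ((Finset.range σ.packets.length).filter
      fun i => ∃ t, S ω t = .transmit i).card := by
    rw [throughput, ← Set.ncard_coe_finset]
    congr 1
    ext i
    simp
  rw [this, Finset.card_filter]
  push_cast
  exact Finset.sum_congr rfl fun i _ => by simp [Set.indicator_apply]

theorem RandomizedOnlineAlgorithm.integrable_value {Ω : Type*} [MeasurableSpace Ω]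
    (R : RandomizedOnlineAlgorithm V Ω) (σ : PacketSequence V) :
    Integrable (fun ω => (R.alg ω).value σ) R.prob := by
  have := R.isProbabilityMeasure
  simp only [OnlineAlgorithm.value, throughput_eq_sum_indicator σ fun ω => (R.alg ω).schedule σ]
  refine integrable_finsetSum _ fun i _ => (integrable_const (1 : ℝ)).indicator ?_
  have : {ω | ∃ t, (R.alg ω).schedule σ t = .transmit i} =
      ⋃ t, (fun ω => (R.alg ω).schedule σ t) ⁻¹' {.transmit i} := by
    ext ω; simp
  rw [this]
  exact MeasurableSet.iUnion fun t => R.measurable_action σ t trivial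

theorem throughput_le_opt (A : OnlineAlgorithm V) (σ : PacketSequence V) :
    A.value σ ≤ opt σ :=
  Nat.cast_le.2 ((opt_isGreatest σ).2 ⟨_, A.feasible σ, rfl⟩)

/-- A finite family of sequences on which all deterministic algorithms do badly on average bounds
the ratios of all algorithms. -/
theorem ratio_le_of_family {L : ℕ} {ι : Type*} (J : Finset ι) (σ : ι → PacketSequence V)
    (hσ : ∀ j ∈ J, (σ j).HasMinLaxity L) {β : ℝ}
    (hpos : 0 < ∑ j ∈ J, (opt (σ j) : ℝ))
    (hA : ∀ A : OnlineAlgorithm V, ∑ j ∈ J, A.value (σ j) ≤ β * ∑ j ∈ J, (opt (σ j) : ℝ)) :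
    (∀ (A : OnlineAlgorithm V) (ρ : ℝ), AchievesRatio A.value L ρ → ρ ≤ β) ∧
      ∀ (Ω : Type*) [MeasurableSpace Ω] (R : RandomizedOnlineAlgorithm V Ω) (ρ : ℝ),
        AchievesRatio R.value L ρ → ρ ≤ β := by
  have key : ∀ (ALG : PacketSequence V → ℝ) (ρ : ℝ), AchievesRatio ALG L ρ →
      ∑ j ∈ J, ALG (σ j) ≤ β * ∑ j ∈ J, (opt (σ j) : ℝ) → ρ ≤ β := by
    intro ALG ρ h hle
    refine le_of_mul_le_mul_right (le_trans ?_ hle) hpos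
    rw [Finset.mul_sum]
    exact Finset.sum_le_sum fun j hj => h _ (hσ j hj)
  refine ⟨fun A ρ h => key _ ρ h (hA A), fun Ω _ R ρ h => key _ ρ h ?_⟩
  have := R.isProbabilityMeasure
  simp only [RandomizedOnlineAlgorithm.value]
  -- The easy half of Yao's principle: after exchanging sum and expectation, the deterministic bound
  -- applies to each outcome `ω`.
  rw [← integral_finsetSum _ fun j _ => R.integrable_value (σ j)]
  refine (integral_mono (integrable_finsetSum _ fun j _ => R.integrable_value (σ j))
    (integrable_const _) fun ω => hA (R.alg ω)).trans ?_
  simp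

end Ratio

/-! ### Two colors at a distance comparable to the laxity -/

section TwoColors

/-- First `L + 1` packets of each of the colors `u` and `v`, then packets of one of the two. -/
def duelPacket (u v : V) (L : ℕ) (b : Bool) (i : ℕ) : Packet V where
  arrival := if i < 2 * (L + 1) then 1 else L + 2
  deadline := if i < 2 * (L + 1) then L + 1 else 2 * (L + 1)
  color := if i < L + 1 then u else if i < 2 * (L + 1) then v else cond b u v
  arrival_pos := by split_ifs <;> omega
  deadline_pos := by split_ifs <;> omega

theorem duelPacket_monotone (u v : V) (L : ℕ) (b : Bool) :
    Monotone fun i => (duelPacket u v L b i).arrival := by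
  intro i j hij
  simp only [duelPacket]
  split_ifs <;> omega

/-- The sequence of the packets `duelPacket`. -/
def duelSeq (u v : V) (L : ℕ) (b : Bool) : PacketSequence V :=
  seqOf (duelPacket u v L b) (duelPacket_monotone u v L b) (3 * (L + 1))

theorem duelSeq_hasMinLaxity (u v : V) (L : ℕ) (b : Bool) : (duelSeq u v L b).HasMinLaxity L := by
  refine hasMinLaxity_seqOf (fun i _ => ?_) ⟨0, by omega, ?_⟩
  · simp only [duelPacket]; split_ifs <;> omega
  · simp only [duelPacket]; split_ifs <;> omega

variable [PseudoMetricSpace V]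

theorem le_opt_duelSeq (u v : V) (L : ℕ) (b : Bool) : 2 * (L + 1) ≤ opt (duelSeq u v L b) := by
  have hcard : (Finset.Icc 1 (2 * (L + 1))).card = 2 * (L + 1) := by simp
  -- Knowing `b`, the schedule transmits only the color that comes back, in every slot and without
  -- transitions.
  refine hcard.symm.le.trans (card_le_opt_seqOf _ (fun t => if t ≤ L + 1 then
    (if b then t - 1 else L + t) else t + L) ?_ ?_ ?_ ?_)
  · intro t ht
    rw [Finset.mem_Icc] at ht
    split_ifs <;> omega
  · intro t ht
    rw [Finset.mem_Icc] at ht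
    simp only [duelPacket]
    constructor <;> split_ifs <;> omega
  · intro t ht t' ht' h
    simp only [Finset.coe_Icc, Set.mem_Icc] at ht ht'
    dsimp only at h
    split_ifs at h <;> omega
  · have hcol : ∀ t ∈ Finset.Icc 1 (2 * (L + 1)), (duelPacket u v L b (if t ≤ L + 1 then
        (if b then t - 1 else L + t) else t + L)).color = cond b u v := by
      intro t ht
      rw [Finset.mem_Icc] at ht
      cases b <;> simp only [duelPacket] <;> split_ifs <;> first | rfl | omega | simp_all
    intro t ht t' ht' htt'
    rw [hcol t ht, hcol t' ht', gap_self]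
    omega

/-- The transmitted colors are connected at the cost of the waste, so a schedule that serves both
colors wastes at least their gap. -/
theorem duelSeq_trichotomy (u v : V) (L : ℕ) (b : Bool) {S : Schedule}
    (hS : Feasible (duelSeq u v L b) S) :
    gap u v ≤ waste S 0 (2 * (L + 1)) ∨
      (∀ t i, S t = .transmit i → (duelPacket u v L b i).color ≠ u) ∨
      ∀ t i, S t = .transmit i → (duelPacket u v L b i).color ≠ v := by
  classical
  have hW : ∀ i < 3 * (L + 1), (duelPacket u v L b i).color ∈ ({u, v} : Finset V) := by
    intro i _
    cases b <;> simp only [duelPacket] <;> split_ifs <;> simp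
  have hslot : ∀ t i, S t = .transmit i → 0 < t ∧ t ≤ 2 * (L + 1) := by
    intro t i h
    obtain ⟨hi, h1⟩ := hS.window t i h
    simp only [duelSeq, getElem_seqOf, duelPacket] at h1
    split_ifs at h1 <;> omega
  rcases exists_spans_of_feasible hS hW 0 (2 * (L + 1)) with h | ⟨X, -, l, hl, hX, hcol⟩
  · exact Or.inr (Or.inl fun t i ht => absurd ht (h t (hslot t i ht).1 (hslot t i ht).2 i))
  · have hcol' : ∀ t i, S t = .transmit i → (duelPacket u v L b i).color ∈ X := fun t i ht =>
      hcol t (hslot t i ht).1 (hslot t i ht).2 i ht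
    by_cases hu : u ∈ X
    · by_cases hv : v ∈ X
      · exact Or.inl ((hX.gap_le u hu v hv).trans hl)
      · exact Or.inr (Or.inr fun t i ht h => hv (h ▸ hcol' t i ht))
    · exact Or.inr (Or.inl fun t i ht h => hu (h ▸ hcol' t i ht))

omit [PseudoMetricSpace V] in
theorem throughput_duelSeq_le_of_lost (u v : V) (L : ℕ) (b : Bool) {S : Schedule} (I : Finset ℕ)
    (hI : ∀ i ∈ I, i < 3 * (L + 1)) (hcard : 2 * (L + 1) ≤ I.card)
    (hlost : ∀ i ∈ I, ∀ t, S t ≠ .transmit i) :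
    throughput (duelSeq u v L b) S ≤ L + 1 := by
  have := throughput_add_card_le (p := duelPacket u v L b) (hp := duelPacket_monotone u v L b)
    (S := S) (a := 0) (b := 0) I hI fun i hi t ht => absurd ht (hlost i hi t)
  rw [duelSeq]
  omega

/-- A schedule that never serves the returning color loses `2 * (L + 1)` packets. In the remaining
case each scenario avoids the color that does not return. As the schedules agree up to slot `L + 1`,
neither color is then served in the first round, which is lost entirely. -/
theorem duel_value_le (u v : V) (L : ℕ) (A : OnlineAlgorithm V) :
    throughput (duelSeq u v L true) (A.schedule (duelSeq u v L true)) +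
      throughput (duelSeq u v L false) (A.schedule (duelSeq u v L false)) +
      min (L + 1) (gap u v) ≤ 4 * (L + 1) := by
  have hfeas := fun b => A.feasible (duelSeq u v L b)
  have hle : ∀ b, throughput (duelSeq u v L b) (A.schedule (duelSeq u v L b)) +
      waste (A.schedule (duelSeq u v L b)) 0 (2 * (L + 1)) ≤ 2 * (L + 1) := fun b =>
    throughput_add_waste_le (hfeas b) fun i _ => by
      simp only [duelPacket]; split_ifs <;> omega
  have h1 := hle true
  have h2 := hle false
  have hown : ∀ b, (∀ t i, A.schedule (duelSeq u v L b) t = .transmit i →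
      (duelPacket u v L b i).color ≠ cond b u v) →
      throughput (duelSeq u v L b) (A.schedule (duelSeq u v L b)) ≤ L + 1 := by
    intro b h
    cases b
    · refine throughput_duelSeq_le_of_lost u v L _ (Finset.Ico (L + 1) (3 * (L + 1)))
        (fun i hi => (Finset.mem_Ico.1 hi).2) (by simp; omega) fun i hi t ht => h t i ht ?_
      rw [Finset.mem_Ico] at hi
      simp only [duelPacket]; split_ifs <;> first | rfl | omega
    · refine throughput_duelSeq_le_of_lost u v L _
        (Finset.Ico 0 (L + 1) ∪ Finset.Ico (2 * (L + 1)) (3 * (L + 1))) ?_ ?_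
        fun i hi t ht => h t i ht ?_
      · intro i hi
        simp only [Finset.mem_union, Finset.mem_Ico] at hi
        omega
      · rw [Finset.card_union_of_disjoint, Nat.card_Ico, Nat.card_Ico]
        · omega
        · refine Finset.disjoint_left.2 fun i hi hi' => ?_
          simp only [Finset.mem_Ico] at hi hi'
          omega
      · simp only [Finset.mem_union, Finset.mem_Ico] at hi
        simp only [duelPacket]; split_ifs <;> first | rfl | omega
  rcases duelSeq_trichotomy u v L true (hfeas true) with h | h | h
  · omega
  · have := hown true h; omega
  rcases duelSeq_trichotomy u v L false (hfeas false) with h' | h' | h'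
  · omega
  · have : throughput (duelSeq u v L true) (A.schedule (duelSeq u v L true)) ≤ L + 1 := by
      refine throughput_duelSeq_le_of_lost u v L _ (Finset.range (2 * (L + 1)))
        (fun i hi => by rw [Finset.mem_range] at hi; omega) (by simp) fun i hi t ht => ?_
      rw [Finset.mem_range] at hi
      have hti : t ≤ L + 1 := by
        obtain ⟨hi', hw⟩ := (hfeas true).window t i ht
        simp only [duelSeq, getElem_seqOf, duelPacket, hi, if_true] at hw
        exact hw.2
      have heq : A.schedule (duelSeq u v L true) t = A.schedule (duelSeq u v L false) t := by
        refine schedule_eq_of_prefix A (a := 2 * (L + 1)) (by omega) (by omega) ?_ ?_ ?_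
        · intro i hi; simp [duelPacket, hi]
        · intro i hi; simp only [duelPacket]; split_ifs <;> omega
        · intro i hi; simp only [duelPacket]; split_ifs <;> omega
      have h3 := h t i ht
      have h4 := h' t i (heq ▸ ht)
      simp only [duelPacket, hi, if_true] at h3 h4
      split_ifs at h3 h4
      · exact h4 rfl
      · exact h3 rfl
    omega
  · have := hown false h'; omega

/-- The bound given by two colors at a distance comparable to the laxity. -/
theorem ratio_le_of_gap {L q : ℕ} (hq : 1 ≤ q) {u v : V} (h : L + 1 ≤ q * gap u v) :
    (∀ (A : OnlineAlgorithm V) (ρ : ℝ), AchievesRatio A.value L ρ → ρ ≤ 1 - 1 / (4 * q)) ∧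
      ∀ (Ω : Type*) [MeasurableSpace Ω] (R : RandomizedOnlineAlgorithm V Ω) (ρ : ℝ),
        AchievesRatio R.value L ρ → ρ ≤ 1 - 1 / (4 * q) := by
  have hq' : (1 : ℝ) ≤ q := by exact_mod_cast hq
  have hopt : (4 * (L + 1) : ℝ) ≤
      ∑ b ∈ (Finset.univ : Finset Bool), (opt (duelSeq u v L b) : ℝ) := by
    rw [Fintype.sum_bool]
    have h1 : (2 * (L + 1) : ℝ) ≤ opt (duelSeq u v L true) := by
      exact_mod_cast le_opt_duelSeq u v L true
    have h2 : (2 * (L + 1) : ℝ) ≤ opt (duelSeq u v L false) := by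
      exact_mod_cast le_opt_duelSeq u v L false
    linarith
  refine ratio_le_of_family Finset.univ (duelSeq u v L)
    (fun b _ => duelSeq_hasMinLaxity u v L b) (lt_of_lt_of_le (by positivity) hopt) fun A => ?_
  have hβ : (0 : ℝ) ≤ 1 - 1 / (4 * q) := by
    rw [sub_nonneg, div_le_one (by positivity)]; linarith
  refine le_trans ?_ (mul_le_mul_of_nonneg_left hopt hβ)
  have hmin : L + 1 ≤ q * min (L + 1) (gap u v) := by
    rcases min_choice (L + 1) (gap u v) with h' | h' <;> rw [h']
    · exact Nat.le_mul_of_pos_left _ hq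
    · exact h
  have hmin' : ((L : ℝ) + 1) ≤ q * (min (L + 1) (gap u v) : ℕ) := by exact_mod_cast hmin
  have hval : (∑ b : Bool, A.value (duelSeq u v L b)) + (min (L + 1) (gap u v) : ℕ) ≤
      4 * (L + 1) := by
    rw [Fintype.sum_bool]
    simp only [OnlineAlgorithm.value]
    exact_mod_cast duel_value_le u v L A
  have : (1 - 1 / (4 * q)) * (4 * (L + 1)) = 4 * ((L : ℝ) + 1) - (L + 1) / q := by
    field_simp
  have hdiv : ((L : ℝ) + 1) / q ≤ (min (L + 1) (gap u v) : ℕ) :=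
    (div_le_iff₀' (by positivity)).2 hmin'
  rw [this]
  linarith

end TwoColors

/-! ### Offline tours through the batches -/

section Tours

/-- A set of points on a line can be visited in increasing order, with one time unit for each
point in addition to the travel time. -/
theorem exists_tour (B : Finset ℕ) (x : ℕ → ℕ) (X : ℕ) (hx : ∀ b, x b ≤ X) :
    ∃ g : ℕ → ℕ, (∀ b ∈ B, g b < B.card + X) ∧ ∀ b ∈ B, ∀ b' ∈ B, b ≠ b' →
      (x b ≤ x b' ∧ g b + x b' < g b' + x b) ∨ (x b' ≤ x b ∧ g b' + x b < g b + x b') := by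
  -- Ties in position are broken by the index, so that distinct points get distinct ranks. The
  -- visiting time is rank plus position.
  let key : ℕ → ℕ ×ₗ ℕ := fun b => toLex (x b, b)
  let rk : ℕ → ℕ := fun b => (B.filter fun a => key a < key b).card
  have hmono : ∀ b ∈ B, ∀ b', key b < key b' → rk b < rk b' := by
    intro b hb b' h
    refine Finset.card_lt_card (Finset.ssubset_iff_of_subset ?_ |>.2 ⟨b, ?_, ?_⟩)
    · exact Finset.monotone_filter_right _ fun a _ ha => ha.trans h
    · simp [hb, h]
    · simp
  have hfst : ∀ b b', key b < key b' → x b ≤ x b' := fun b b' h =>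
    (Prod.Lex.monotone_fst _ _ h.le :)
  refine ⟨fun b => rk b + x b, fun b hb => ?_, fun b hb b' hb' hne => ?_⟩
  · have : rk b < B.card := Finset.card_lt_card
      (Finset.ssubset_iff_of_subset (Finset.filter_subset _ _) |>.2 ⟨b, hb, by simp⟩)
    have := hx b
    dsimp only
    omega
  · dsimp only
    rcases lt_trichotomy (key b) (key b') with h | h | h
    · have := hmono b hb b' h
      have := hfst b b' h
      omega
    · exact absurd (congrArg (fun z => (ofLex z).2) h) hne
    · have := hmono b' hb' b h
      have := hfst b' b h
      omega

/-- Batches of `N` points arrive in the first slot of each of `j` periods of `T` slots. They can be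
visited by tours at the end of every `K`-th period, the last one included. -/
theorem exists_tours {j T N K M : ℕ} (hK : 0 < K) (hN : 0 < N)
    (hT : K * N + 6 * M ≤ T) (x : ℕ → ℕ) (hx : ∀ b, x b ≤ 2 * M) :
    ∃ (τ : ℕ → ℕ) (Z : Finset ℕ), (∀ t ∈ Z, 1 ≤ t ∧ t ≤ j * T) ∧
      Z.card ≤ j * N + 6 * M * ((j - 1) / K + 1) ∧
      (∀ b < j * N, τ b ∈ Z ∧ b / N * T < τ b) ∧
      (∀ b < j * N, ∀ t ∉ Z, (t < τ b → 2 * M + t < τ b) ∧ (τ b < t → 2 * M + τ b < t)) ∧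
      ∀ b < j * N, ∀ b' < j * N, b ≠ b' → τ b ≠ τ b' ∧
        (τ b < τ b' → 2 * M + τ b < τ b' ∨ (x b ≤ x b' ∧ x b' + τ b < τ b' + x b)) := by
  -- Tours are numbered backwards from the last period, so that tour `0` always ends with period `j
  -- - 1`. A smaller `q` means a later tour.
  let q : ℕ → ℕ := fun b => (j - 1 - b / N) / K
  let B : ℕ → Finset ℕ := fun i => (Finset.range (j * N)).filter fun b => q b = i
  have hBmem : ∀ b < j * N, b ∈ B (q b) := fun b hb => by simp [B, hb]
  have hdiv : ∀ b < j * N, b / N + 1 ≤ j := fun b hb =>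
    Nat.div_lt_of_lt_mul (by rwa [Nat.mul_comm])
  have hq : ∀ b, K * q b ≤ j - 1 - b / N := fun b => Nat.mul_div_le _ _
  have hq' : ∀ b, j - 1 - b / N < K * q b + K := fun b => by
    have := Nat.lt_mul_div_succ (j - 1 - b / N) hK
    rwa [Nat.mul_add, Nat.mul_one] at this
  have hBcard : ∀ i, (B i).card ≤ K * N := by
    intro i
    have hsub : B i ⊆ Finset.Ico ((j - K * i - K) * N) ((j - K * i) * N) := by
      intro b hb
      simp only [B, Finset.mem_filter, Finset.mem_range] at hb
      obtain ⟨hb, rfl⟩ := hb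
      have h1 := hdiv b hb
      have h2 := hq b
      have h3 := hq' b
      rw [Finset.mem_Ico]
      constructor
      · refine (Nat.le_div_iff_mul_le hN).1 ?_
        generalize b / N = c at *
        omega
      · refine (Nat.div_lt_iff_lt_mul hN).1 ?_
        generalize b / N = c at *
        omega
    refine (Finset.card_le_card hsub).trans ?_
    rw [Nat.card_Ico, ← Nat.sub_mul]
    exact Nat.mul_le_mul_right _ (by omega)
  choose g hg hg' using fun i => exists_tour (B i) x (2 * M) hx
  let en : ℕ → ℕ := fun i => (j - K * i) * T
  -- Of the `6 * M` extra slots of a tour, `2 * M` are for the way in, `2 * M` for travel within the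
  -- tour and `2 * M` for the way out. The subtraction does not truncate, since the tour fits into
  -- one period.
  let τ : ℕ → ℕ := fun b => en (q b) - ((B (q b)).card + 6 * M) + 2 * M + g (q b) b + 1
  let Z : Finset ℕ := (Finset.range ((j - 1) / K + 1)).biUnion fun i =>
    Finset.Ioc (en i - ((B i).card + 6 * M)) (en i)
  have hTle : ∀ b < j * N, b / N * T + T ≤ en (q b) := by
    intro b hb
    have h1 := hdiv b hb
    have h2 := hq b
    rw [← Nat.succ_mul]
    exact Nat.mul_le_mul_right _ (by omega)
  have hg1 : ∀ b < j * N, g (q b) b < (B (q b)).card + 2 * M := fun b hb =>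
    hg _ b (hBmem b hb)
  have hQ : ∀ b, (B (q b)).card + 6 * M ≤ T := fun b =>
    (Nat.add_le_add_right (hBcard _) _).trans hT
  have hτ : ∀ b, τ b = en (q b) - ((B (q b)).card + 6 * M) + 2 * M + g (q b) b + 1 :=
    fun b => rfl
  have hZ : ∀ b < j * N, ∀ t, en (q b) - ((B (q b)).card + 6 * M) < t → t ≤ en (q b) → t ∈ Z := by
    intro b hb t ht ht'
    refine Finset.mem_biUnion.2 ⟨q b, ?_, Finset.mem_Ioc.2 ⟨ht, ht'⟩⟩
    rw [Finset.mem_range]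
    exact Nat.lt_succ_of_le (Nat.div_le_div_right (Nat.sub_le _ _))
  have hne : ∀ b < j * N, ∀ b' < j * N, q b < q b' → τ b' + 2 * M < τ b := by
    intro b hb b' hb' h
    have h1 : en (q b') + T ≤ en (q b) := by
      simp only [en]
      rw [← Nat.succ_mul]
      refine Nat.mul_le_mul_right _ ?_
      have h2 : K * q b + K ≤ K * q b' := by
        rw [← Nat.mul_succ]; exact Nat.mul_le_mul_left _ h
      have := hq b'
      have := hdiv b' hb'
      have := hq b
      generalize b / N = c at *
      generalize b' / N = c' at *
      omega
    have := hg1 b' hb'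
    have := hQ b
    have := hQ b'
    have := hTle b' hb'
    rw [hτ, hτ]
    omega
  refine ⟨τ, Z, ?_, ?_, ?_, ?_, ?_⟩
  · intro t ht
    obtain ⟨i, -, ht⟩ := Finset.mem_biUnion.1 ht
    rw [Finset.mem_Ioc] at ht
    have : en i ≤ j * T := Nat.mul_le_mul_right _ (Nat.sub_le _ _)
    omega
  · refine Finset.card_biUnion_le.trans ?_
    calc ∑ i ∈ Finset.range ((j - 1) / K + 1),
          (Finset.Ioc (en i - ((B i).card + 6 * M)) (en i)).card
        ≤ ∑ i ∈ Finset.range ((j - 1) / K + 1), ((B i).card + 6 * M) :=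
          Finset.sum_le_sum fun i _ => by rw [Nat.card_Ioc]; omega
      _ = j * N + 6 * M * ((j - 1) / K + 1) := by
          rw [Finset.sum_add_distrib, Finset.sum_const, Finset.card_range, smul_eq_mul,
            Nat.mul_comm (6 * M), ← Finset.card_eq_sum_card_fiberwise, Finset.card_range]
          intro b _
          simp only [Finset.coe_range, Set.mem_Iio, q]
          exact Nat.lt_succ_of_le (Nat.div_le_div_right (Nat.sub_le _ _))
  · intro b hb
    have := hg1 b hb
    have := hQ b
    have := hTle b hb
    have := hτ b
    exact ⟨hZ b hb _ (by omega) (by omega), by omega⟩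
  · intro b hb t ht
    have := hg1 b hb
    have := hQ b
    have := hTle b hb
    have := hτ b
    have h := mt (hZ b hb t)
    by_cases h1 : en (q b) - ((B (q b)).card + 6 * M) < t
    · have h2 : ¬ t ≤ en (q b) := fun h2 => ht (hZ b hb t h1 h2)
      omega
    · omega
  · intro b hb b' hb' hbb'
    rcases lt_trichotomy (q b) (q b') with h | h | h
    · have := hne b hb b' hb' h
      omega
    · have h1 := hτ b
      have h2 := hτ b'
      rw [← h] at h2
      have h3 := hg' (q b) b (hBmem b hb) b' (h ▸ hBmem b' hb') hbb'
      omega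
    · have := hne b' hb' b hb h
      omega

/-- A finite set of colors with multiplicities can be listed. -/
theorem exists_coloring [DecidableEq V] (W : Finset V) (n : V → ℕ) (r : V) :
    ∃ col : ℕ → V, (∀ y < ∑ v ∈ W, n v, col y ∈ W) ∧
      ∀ v ∈ W, ((Finset.range (∑ v ∈ W, n v)).filter fun y => col y = v).card = n v := by
  induction W using Finset.induction_on with
  | empty => exact ⟨fun _ => r, by simp, by simp⟩
  | insert a s ha ih =>
    obtain ⟨col, h1, h2⟩ := ih
    rw [Finset.sum_insert ha]
    set S := ∑ v ∈ s, n v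
    refine ⟨fun y => if y < S then col y else a, fun y hy => ?_, fun v hv => ?_⟩
    · by_cases h : y < S
      · simpa [h] using Or.inr (h1 y h)
      · simp [h]
    · rcases Finset.mem_insert.1 hv with rfl | hv'
      · have : ((Finset.range (n v + S)).filter fun y => (if y < S then col y else v) = v) =
            Finset.Ico S (n v + S) := by
          ext y
          simp only [Finset.mem_filter, Finset.mem_range, Finset.mem_Ico]
          refine ⟨fun ⟨hy, h⟩ => ⟨?_, hy⟩, fun ⟨hy, h⟩ => ⟨h, by simp [hy.not_gt]⟩⟩
          by_contra hc
          rw [if_pos (by omega)] at h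
          exact ha (h ▸ h1 y (by omega))
        rw [this, Nat.card_Ico]
        omega
      · rw [← h2 v hv']
        congr 1
        ext y
        simp only [Finset.mem_filter, Finset.mem_range]
        have hva : a ≠ v := fun h => ha (h ▸ hv')
        refine ⟨fun ⟨hy, h⟩ => ?_, fun ⟨hy, h⟩ => ⟨by omega, by simpa [hy] using h⟩⟩
        split_ifs at h with hc
        · exact ⟨hc, h⟩
        · exact absurd h hva

theorem exists_injOn_lt (E : Finset ℕ) :
    ∃ φ : ℕ → ℕ, Set.InjOn φ E ∧ ∀ t ∈ E, φ t < E.card := by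
  obtain ⟨g, hg, hg'⟩ := exists_tour E (fun _ => 0) 0 (fun _ => le_rfl)
  refine ⟨g, fun a ha b hb hab => ?_, fun t ht => by simpa using hg t ht⟩
  by_contra hne
  have := hg' a ha b hb hne
  omega

end Tours

/-! ### The adversary with batches and a final flood -/

/-- The parameters of the adversary: `m` periods of `T` slots, batches of `N` packets with colors
`col`, and many packets of color `root`. -/
structure FloodGame (V : Type*) where
  L : ℕ
  T : ℕ
  N : ℕ
  m : ℕ
  root : V
  col : ℕ → V
  batch_pos : 0 < N
  batch_le : N ≤ T
  horizon_le : m * T ≤ L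

namespace FloodGame

variable (G : FloodGame V)

/-- The last slot, which is also the number of packets. -/
def H : ℕ := 2 * (G.m * G.T) + G.L + 1

/-- The packets of the scenario with `j` batches, which is ended by a flood of `L + 1` urgent
packets of color `root`. The first `m * T` and the last packets have the deadline `H`. -/
def packet (j i : ℕ) : Packet V where
  arrival :=
    if i < G.m * G.T then 1
    else if i < G.m * G.T + j * G.N then (i - G.m * G.T) / G.N * G.T + 1
    else j * G.T + 1
  deadline :=
    if i < G.m * G.T then G.H
    else if i < G.m * G.T + j * G.N then (i - G.m * G.T) / G.N * G.T + 1 + G.L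
    else if i < G.m * G.T + j * G.N + (G.L + 1) then j * G.T + 1 + G.L
    else G.H
  color :=
    if i < G.m * G.T then G.root
    else if i < G.m * G.T + j * G.N then G.col ((i - G.m * G.T) % G.N)
    else G.root
  arrival_pos := by split_ifs <;> omega
  deadline_pos := by unfold H; split_ifs <;> omega

theorem div_lt {j i : ℕ} (h : i < j * G.N) : i / G.N < j :=
  Nat.div_lt_of_lt_mul (by rwa [Nat.mul_comm])

theorem div_mul_le {j i : ℕ} (h : i < j * G.N) : i / G.N * G.T + G.T ≤ j * G.T := by
  rw [← Nat.succ_mul]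
  exact Nat.mul_le_mul_right _ (G.div_lt h)

theorem mul_le_of_le {j : ℕ} (hj : j ≤ G.m) : j * G.T ≤ G.m * G.T := Nat.mul_le_mul_right _ hj

theorem mul_batch_le (j : ℕ) : j * G.N ≤ j * G.T := Nat.mul_le_mul_left _ G.batch_le

theorem packet_monotone (j : ℕ) : Monotone fun i => (G.packet j i).arrival := by
  intro a b hab
  have h : ∀ i, i - G.m * G.T < j * G.N → _ := fun i hi => G.div_mul_le hi
  have h1 : (a - G.m * G.T) / G.N * G.T ≤ (b - G.m * G.T) / G.N * G.T :=
    Nat.mul_le_mul_right _ (Nat.div_le_div_right (Nat.sub_le_sub_right hab _))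
  have ha := h a
  simp only [packet]
  split_ifs <;> omega

/-- The sequence of the scenario with `j` batches. -/
def seq (j : ℕ) : PacketSequence V := seqOf (G.packet j) (G.packet_monotone j) G.H

theorem packet_bounds {j i : ℕ} (hj : j ≤ G.m) :
    (G.packet j i).arrival + G.L ≤ (G.packet j i).deadline ∧ (G.packet j i).deadline ≤ G.H := by
  have h := G.mul_le_of_le hj
  have h1 : i - G.m * G.T < j * G.N → _ := fun hi => G.div_mul_le hi
  simp only [packet, H]
  split_ifs <;> omega

theorem seq_hasMinLaxity {j : ℕ} (hj : j ≤ G.m) : (G.seq j).HasMinLaxity G.L := by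
  refine hasMinLaxity_seqOf (fun i _ => (G.packet_bounds hj).1) ⟨G.m * G.T + j * G.N, ?_, ?_⟩
  · have := G.mul_le_of_le hj
    have := G.mul_batch_le j
    simp only [H]; omega
  · simp only [packet]
    split_ifs <;> omega

theorem packet_eq {j i : ℕ} (hj : j ≤ G.m) (hi : i < G.m * G.T + j * G.N) :
    G.packet j i = G.packet G.m i := by
  have : j * G.N ≤ G.m * G.N := Nat.mul_le_mul_right _ hj
  have hi' : i < G.m * G.T + G.m * G.N := by omega
  by_cases h : i < G.m * G.T <;> simp [packet, hi, hi', h]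

theorem lt_arrival {j j' i : ℕ} (hj : j ≤ j') (hi : G.m * G.T + j * G.N ≤ i) :
    j * G.T < (G.packet j' i).arrival := by
  have h1 : j * G.T ≤ j' * G.T := Nat.mul_le_mul_right _ hj
  have h2 : j * G.T ≤ (i - G.m * G.T) / G.N * G.T :=
    Nat.mul_le_mul_right _ ((Nat.le_div_iff_mul_le G.batch_pos).2 (by omega))
  simp only [packet]
  split_ifs <;> omega

theorem packet_batch {j k y : ℕ} (hk : k < j) (hy : y < G.N) :
    (G.packet j (G.m * G.T + k * G.N + y)).arrival = k * G.T + 1 ∧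
    (G.packet j (G.m * G.T + k * G.N + y)).deadline = k * G.T + 1 + G.L ∧
    (G.packet j (G.m * G.T + k * G.N + y)).color = G.col y := by
  have h1 : k * G.N + G.N ≤ j * G.N := by
    rw [← Nat.succ_mul]; exact Nat.mul_le_mul_right _ hk
  have h2 : ¬ G.m * G.T + k * G.N + y < G.m * G.T := by omega
  have h3 : G.m * G.T + k * G.N + y < G.m * G.T + j * G.N := by omega
  have h4 : G.m * G.T + k * G.N + y - G.m * G.T = y + G.N * k := by
    rw [Nat.mul_comm G.N]; omega
  simp [packet, h2, h3, h4, Nat.add_mul_div_left _ _ G.batch_pos, Nat.div_eq_of_lt hy,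
    Nat.mod_eq_of_lt hy]

variable [PseudoMetricSpace V]

/-- Until the flood, scenario `j` cannot be told from the scenario with all batches. Waste and
pending packets can therefore be read off a single schedule. -/
theorem schedule_eq (A : OnlineAlgorithm V) {j t : ℕ} (hj : j ≤ G.m) (ht : t ≤ j * G.T) :
    A.schedule (G.seq j) t = A.schedule (G.seq G.m) t := by
  have hH : G.m * G.T + j * G.N ≤ G.H := by
    have := G.mul_le_of_le hj
    have := G.mul_batch_le j
    simp only [H]; omega
  exact schedule_eq_of_prefix A hH hH (fun i hi => G.packet_eq hj hi)
    (fun i hi => ht.trans_lt (G.lt_arrival le_rfl hi)) fun i hi => ht.trans_lt (G.lt_arrival hj hi)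

open scoped Classical in
/-- The packets of batch `k` that are not transmitted during the period `k`. -/
def pending (S : Schedule) (k : ℕ) : Finset ℕ :=
  (Finset.range G.N).filter fun y =>
    ∀ t, k * G.T < t → t ≤ (k + 1) * G.T → S t ≠ .transmit (G.m * G.T + k * G.N + y)

/-- The pending packets of the last batch and the `L + 1` packets of the flood all compete for the
`L + 1` slots after period `k`. As there are `H` packets altogether, as many are lost as were
pending. -/
theorem throughput_add_pending_le (A : OnlineAlgorithm V) {k : ℕ} (hk : k < G.m) :
    throughput (G.seq (k + 1)) (A.schedule (G.seq (k + 1))) +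
      (G.pending (A.schedule (G.seq G.m)) k).card ≤ G.H := by
  classical
  set P := G.pending (A.schedule (G.seq G.m)) k with hP
  have hkT := G.mul_le_of_le (show k + 1 ≤ G.m from hk)
  have hkN : (k + 1) * G.N = k * G.N + G.N := Nat.succ_mul _ _
  have hkT' : (k + 1) * G.T = k * G.T + G.T := Nat.succ_mul _ _
  have hNT := G.mul_batch_le (k + 1)
  set F := Finset.Ico (G.m * G.T + (k + 1) * G.N) (G.m * G.T + (k + 1) * G.N + (G.L + 1)) with hF
  have hmemP : ∀ i ∈ P.map (addLeftEmbedding (G.m * G.T + k * G.N)),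
      ∃ y < G.N, y ∈ P ∧ i = G.m * G.T + k * G.N + y := by
    intro i hi
    obtain ⟨y, hy, rfl⟩ := Finset.mem_map.1 hi
    exact ⟨y, Finset.mem_range.1 (Finset.mem_filter.1 hy).1, hy, rfl⟩
  have hcard : (P.map (addLeftEmbedding (G.m * G.T + k * G.N)) ∪ F).card =
      P.card + (G.L + 1) := by
    rw [Finset.card_union_of_disjoint, Finset.card_map, hF, Nat.card_Ico]
    · omega
    · refine Finset.disjoint_left.2 fun i hi hi' => ?_
      obtain ⟨y, hy, -, rfl⟩ := hmemP i hi
      rw [hF, Finset.mem_Ico] at hi'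
      omega
  have h := throughput_add_card_le (p := G.packet (k + 1)) (hp := G.packet_monotone (k + 1))
    (n := G.H) (S := A.schedule (G.seq (k + 1))) (a := (k + 1) * G.T)
    (b := (k + 1) * G.T + 1 + G.L)
    (P.map (addLeftEmbedding (G.m * G.T + k * G.N)) ∪ F) ?_ ?_
  · rw [hcard] at h
    rw [seq] at h ⊢
    omega
  · intro i hi
    simp only [H]
    rcases Finset.mem_union.1 hi with hi | hi
    · obtain ⟨y, hy, -, rfl⟩ := hmemP i hi
      omega
    · rw [hF, Finset.mem_Ico] at hi
      omega
  · intro i hi t ht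
    obtain ⟨hi', hw⟩ := (A.feasible (G.seq (k + 1))).window t i ht
    simp only [seq, getElem_seqOf] at hw
    rcases Finset.mem_union.1 hi with hi | hi
    · obtain ⟨y, hy, hyP, rfl⟩ := hmemP i hi
      obtain ⟨h1, h2, -⟩ := G.packet_batch (Nat.lt_succ_self k) hy
      rw [Nat.succ_eq_add_one] at h1 h2
      rw [h1, h2] at hw
      refine ⟨?_, by omega⟩
      by_contra hc
      have hc : t ≤ (k + 1) * G.T := by omega
      exact (Finset.mem_filter.1 hyP).2 t (by omega) hc
        (by rw [← G.schedule_eq A hk hc]; exact ht)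
    · rw [hF, Finset.mem_Ico] at hi
      refine ⟨(G.lt_arrival le_rfl hi.1).trans_le hw.1, hw.2.trans ?_⟩
      simp only [packet]
      split_ifs <;> omega

theorem throughput_add_sum_waste_le (A : OnlineAlgorithm V) {j : ℕ} (hj : j ≤ G.m) :
    throughput (G.seq j) (A.schedule (G.seq j)) +
      ∑ k ∈ Finset.range j,
        waste (A.schedule (G.seq G.m)) (k * G.T) ((k + 1) * G.T) ≤ G.H := by
  have h1 : throughput (G.seq j) _ + waste (A.schedule (G.seq j)) 0 G.H ≤ G.H :=
    throughput_add_waste_le (A.feasible (G.seq j)) fun i _ => (G.packet_bounds hj).2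
  have hle : j * G.T ≤ G.H := by
    have := G.mul_le_of_le hj
    simp only [H]; omega
  have h3 : waste (A.schedule (G.seq j)) 0 (j * G.T) =
      waste (A.schedule (G.seq G.m)) 0 (j * G.T) :=
    waste_congr fun t _ ht => G.schedule_eq A hj ht
  rw [← waste_eq_sum, ← h3]
  have h2 := waste_add (A.schedule (G.seq j)) (Nat.zero_le (j * G.T)) hle
  omega

/-- In each period an algorithm wastes slots or leaves packets of the last batch pending. -/
theorem charge_le [DecidableEq V] (A : OnlineAlgorithm V) {W : Finset V} {C κ : ℕ}
    (hroot : G.root ∈ W) (hcol : ∀ y < G.N, G.col y ∈ W) (hC : C ≤ G.N)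
    (hcharge : ∀ X ⊆ W, ∀ l, Spans X l →
      C ≤ κ * l + ((Finset.range G.N).filter fun y => G.col y ∉ X).card) {k : ℕ} (hk : k < G.m) :
    C ≤ κ * waste (A.schedule (G.seq G.m)) (k * G.T) ((k + 1) * G.T) +
      (G.pending (A.schedule (G.seq G.m)) k).card := by
  classical
  have hW : ∀ i < G.H, (G.packet G.m i).color ∈ W := by
    intro i _
    simp only [packet]
    split_ifs
    · exact hroot
    · exact hcol _ (Nat.mod_lt _ G.batch_pos)
    · exact hroot
  rcases exists_spans_of_feasible (A.feasible (G.seq G.m)) hW (k * G.T) ((k + 1) * G.T) with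
    h | ⟨X, hXW, l, hl, hX, hcolX⟩
  · have : G.pending (A.schedule (G.seq G.m)) k = Finset.range G.N :=
      Finset.filter_true_of_mem fun y _ t ht ht' => h t ht ht' _
    rw [this, Finset.card_range]
    omega
  · refine (hcharge X hXW l hX).trans (Nat.add_le_add (Nat.mul_le_mul_left _ hl)
      (Finset.card_le_card fun y hy => ?_))
    obtain ⟨hy, hyX⟩ := Finset.mem_filter.1 hy
    refine Finset.mem_filter.2 ⟨hy, fun t ht ht' h => hyX ?_⟩
    rw [← (G.packet_batch hk (Finset.mem_range.1 hy)).2.2]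
    exact hcolX t ht ht' _ h

/-- The two upper bounds on each throughput are added. Pending packets of period `i` count once, in
the scenario that stops after it. Waste of a period `i < κ` counts in all later scenarios, in
particular in the `κ` scenarios of the second half. Each of the first `κ` periods thus contributes
at least `κ * waste + pending ≥ C`. -/
theorem sum_throughput_le (A : OnlineAlgorithm V) {C κ : ℕ} (hm : G.m = 2 * κ)
    (hcharge : ∀ k < G.m, C ≤ κ * waste (A.schedule (G.seq G.m)) (k * G.T) ((k + 1) * G.T) +
      (G.pending (A.schedule (G.seq G.m)) k).card) :
    2 * ∑ k ∈ Finset.range G.m, throughput (G.seq (k + 1)) (A.schedule (G.seq (k + 1))) +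
      κ * C ≤ 2 * (G.m * G.H) := by
  set val := fun k => throughput (G.seq (k + 1)) (A.schedule (G.seq (k + 1))) with hval
  set w := fun k => waste (A.schedule (G.seq G.m)) (k * G.T) ((k + 1) * G.T) with hw
  set q := fun k => (G.pending (A.schedule (G.seq G.m)) k).card with hq
  have h1 : ∀ k ∈ Finset.range G.m, 2 * val k + (q k + ∑ i ∈ Finset.range (k + 1), w i) ≤
      2 * G.H := by
    intro k hk
    rw [Finset.mem_range] at hk
    have ha : val k + q k ≤ G.H := G.throughput_add_pending_le A hk
    have hb : val k + ∑ i ∈ Finset.range (k + 1), w i ≤ G.H :=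
      G.throughput_add_sum_waste_le A (show k + 1 ≤ G.m from hk)
    omega
  have h2 := Finset.sum_le_sum h1
  rw [Finset.sum_add_distrib, Finset.sum_add_distrib, ← Finset.mul_sum, Finset.sum_const,
    Finset.card_range, smul_eq_mul] at h2
  have h3 : ∑ i ∈ Finset.range κ, q i ≤ ∑ i ∈ Finset.range G.m, q i :=
    Finset.sum_le_sum_of_subset (Finset.range_subset_range.2 (by omega))
  have h4 : κ * ∑ i ∈ Finset.range κ, w i ≤
      ∑ k ∈ Finset.range G.m, ∑ i ∈ Finset.range (k + 1), w i := by
    have hcard : (Finset.Ico κ G.m).card = κ := by rw [Nat.card_Ico]; omega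
    calc κ * ∑ i ∈ Finset.range κ, w i
        = ∑ k ∈ Finset.Ico κ G.m, ∑ i ∈ Finset.range κ, w i := by
          rw [Finset.sum_const, hcard, smul_eq_mul]
      _ ≤ ∑ k ∈ Finset.Ico κ G.m, ∑ i ∈ Finset.range (k + 1), w i := by
          refine Finset.sum_le_sum fun k hk => Finset.sum_le_sum_of_subset ?_
          rw [Finset.mem_Ico] at hk
          exact Finset.range_subset_range.2 (by omega)
      _ ≤ _ := by
          refine Finset.sum_le_sum_of_subset fun k hk => ?_
          rw [Finset.mem_Ico] at hk
          exact Finset.mem_range.2 hk.2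
  have h5 : κ * C ≤ κ * (∑ i ∈ Finset.range κ, w i) + ∑ i ∈ Finset.range κ, q i := by
    rw [Finset.mul_sum, ← Finset.sum_add_distrib]
    calc κ * C = ∑ i ∈ Finset.range κ, C := by simp
      _ ≤ _ := Finset.sum_le_sum fun i hi => by
        rw [Finset.mem_range] at hi
        exact hcharge i (by omega)
  rw [show G.m * (2 * G.H) = 2 * (G.m * G.H) by ring] at h2
  change 2 * ∑ k ∈ Finset.range G.m, val k + κ * C ≤ 2 * (G.m * G.H)
  omega

/-- The optimal schedule visits the batches by tours at regular intervals and transmits packets of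
color `root` in between. -/
theorem le_opt_seq {W : Finset V} {j K M : ℕ} (hK : 0 < K)
    (hT : K * G.N + 6 * M ≤ G.T) (hj : j ≤ G.m) (hroot : G.root ∈ W)
    (hcol : ∀ y < G.N, G.col y ∈ W) {x : V → ℕ} (hx : ∀ v ∈ W, x v ≤ 2 * M)
    (hgap : ∀ u ∈ W, ∀ v ∈ W, x u ≤ x v → x u + gap u v ≤ x v) :
    G.H ≤ opt (G.seq j) + 6 * M * ((j - 1) / K + 1) := by
  classical
  have hcolW : ∀ b, G.col (b % G.N) ∈ W := fun b => hcol _ (Nat.mod_lt _ G.batch_pos)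
  have hgapM : ∀ u ∈ W, ∀ v ∈ W, gap u v ≤ 2 * M := by
    intro u hu v hv
    have h1 := hx u hu
    have h2 := hx v hv
    rcases le_total (x u) (x v) with h | h
    · have := hgap u hu v hv h; omega
    · have := hgap v hv u hu h
      rw [gap_comm] at this; omega
  obtain ⟨τ, Z, hZ, hZcard, hτ, hsepZ, hsep⟩ := exists_tours hK G.batch_pos hT
    (j := j) (fun b => x (G.col (b % G.N))) fun b => hx _ (hcolW b)
  have hjT := G.mul_le_of_le hj
  have hjN := G.mul_batch_le j
  -- Since `m * T ≤ L`, no batch packet expires before its tour, however late this tour is.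
  have hmL := G.horizon_le
  set B := Finset.range (j * G.N) with hB
  have hinjτ : Set.InjOn τ B := by
    intro b hb b' hb' h
    by_contra hne
    exact (hsep b (Finset.mem_range.1 hb) b' (Finset.mem_range.1 hb') hne).1 h
  have himage : B.image τ ⊆ Z := by
    intro t ht
    obtain ⟨b, hb, rfl⟩ := Finset.mem_image.1 ht
    exact (hτ b (Finset.mem_range.1 hb)).1
  have hcardB : (B.image τ).card = j * G.N := by
    rw [Finset.card_image_of_injOn hinjτ, Finset.card_range]
  have hZle : j * G.N ≤ Z.card := hcardB ▸ Finset.card_le_card himage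
  -- the slots of the packets that are available all the time
  set c := j * G.T + 1 + G.L + (G.m * G.T - j * G.N) with hc
  have hcH : c ≤ G.H := by simp only [H]; omega
  set E' := (Finset.Icc 1 (j * G.T) \ Z) ∪ Finset.Ioc c G.H with hE'
  have hZsub : Z ⊆ Finset.Icc 1 (j * G.T) := fun t ht => Finset.mem_Icc.2 (hZ t ht)
  have hE'card : E'.card ≤ G.m * G.T := by
    refine (Finset.card_union_le _ _).trans ?_
    rw [Finset.card_sdiff_of_subset hZsub, Nat.card_Icc, Nat.card_Ioc]
    simp only [H]
    omega
  obtain ⟨φ, hφinj, hφlt⟩ := exists_injOn_lt E'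
  set E := B.image τ ∪ (Finset.Icc 1 G.H \ Z) with hE
  have hZH : Z ⊆ Finset.Icc 1 G.H := fun t ht => by
    have := hZ t ht
    rw [Finset.mem_Icc]
    simp only [H]
    omega
  have hEcard : E.card = j * G.N + (G.H - Z.card) := by
    rw [hE, Finset.card_union_of_disjoint, hcardB, Finset.card_sdiff_of_subset hZH, Nat.card_Icc,
      Nat.add_sub_cancel]
    exact Finset.disjoint_left.2 fun t ht ht' => (Finset.mem_sdiff.1 ht').2 (himage ht)
  have hZcH : Z.card ≤ G.H := by simpa using Finset.card_le_card hZH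
  let f : ℕ → ℕ := fun t =>
    if t ∈ B.image τ then G.m * G.T + Function.invFunOn τ B t
    else if j * G.T < t ∧ t ≤ c then G.m * G.T + j * G.N + (t - j * G.T - 1)
    else φ t
  have hclass : ∀ t ∈ E,
      (∃ b < j * G.N, τ b = t ∧ f t = G.m * G.T + b) ∨
      (t ∉ Z ∧ j * G.T < t ∧ t ≤ c ∧ f t = G.m * G.T + j * G.N + (t - j * G.T - 1)) ∨
      (t ∉ Z ∧ t ∈ E' ∧ 1 ≤ t ∧ t ≤ G.H ∧ f t = φ t ∧ φ t < G.m * G.T) := by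
    intro t ht
    by_cases htB : t ∈ B.image τ
    · have hex : ∃ b ∈ (B : Set ℕ), τ b = t := by simpa using htB
      exact Or.inl ⟨Function.invFunOn τ B t, Finset.mem_range.1 (Function.invFunOn_mem hex),
        Function.invFunOn_eq hex, by simp only [f, htB, if_true]⟩
    · obtain ⟨ht1, htZ⟩ : t ∈ Finset.Icc 1 G.H ∧ t ∉ Z := by
        rcases Finset.mem_union.1 ht with h | h
        · exact absurd h htB
        · exact Finset.mem_sdiff.1 h
      rw [Finset.mem_Icc] at ht1
      right
      by_cases hcase : j * G.T < t ∧ t ≤ c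
      · exact Or.inl ⟨htZ, hcase.1, hcase.2, by simp only [f, htB, hcase, if_true, if_false,
          and_self]⟩
      · have htE' : t ∈ E' := by
          simp only [hE', Finset.mem_union, Finset.mem_sdiff, Finset.mem_Icc, Finset.mem_Ioc]
          by_cases h : t ≤ j * G.T
          · exact Or.inl ⟨⟨ht1.1, h⟩, htZ⟩
          · exact Or.inr ⟨by omega, ht1.2⟩
        exact Or.inr ⟨htZ, htE', ht1.1, ht1.2, by simp only [f, htB, hcase, if_false],
          (hφlt t htE').trans_le hE'card⟩
  have hcolor : ∀ t ∈ E, (∃ b < j * G.N, τ b = t ∧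
      (G.packet j (f t)).color = G.col (b % G.N)) ∨
      (t ∉ Z ∧ (G.packet j (f t)).color = G.root) := by
    intro t ht
    rcases hclass t ht with ⟨b, hb, hbt, h⟩ | ⟨hZ, -, -, h⟩ | ⟨hZ, -, -, -, h, hlt⟩
    · exact Or.inl ⟨b, hb, hbt, by simp [packet, h, hb]⟩
    · refine Or.inr ⟨hZ, ?_⟩
      rw [h]
      simp only [packet]
      split_ifs <;> first | rfl | omega
    · refine Or.inr ⟨hZ, ?_⟩
      rw [h]
      simp only [packet, hlt, if_true]
  suffices h : E.card ≤ opt (G.seq j) by omega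
  refine card_le_opt_seqOf E f ?_ ?_ ?_ ?_
  · intro t ht
    rcases hclass t ht with ⟨b, hb, hbt, h⟩ | ⟨-, h1, h2, h⟩ | ⟨-, -, h1, h2, h, hlt⟩ <;> rw [h] <;>
      simp only [H] <;> omega
  · intro t ht
    rcases hclass t ht with ⟨b, hb, hbt, h⟩ | ⟨-, h1, h2, h⟩ | ⟨-, -, h1, h2, h, hlt⟩
    · have h1 := hτ b hb
      have h2 := hZ _ h1.1
      have h3 : ¬ G.m * G.T + b < G.m * G.T := by omega
      have h4 : G.m * G.T + b < G.m * G.T + j * G.N := by omega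
      simp only [h, packet, h3, h4, if_true, if_false, Nat.add_sub_cancel_left]
      omega
    · rw [h]
      simp only [packet, H]
      constructor <;> split_ifs <;> omega
    · rw [h]
      simp only [packet, hlt, if_true]
      omega
  · intro t ht t' ht' htt'
    rcases hclass t ht with ⟨b, hb, hbt, h⟩ | ⟨-, h1, h2, h⟩ | ⟨-, hE1, h1, h2, h, hlt⟩ <;>
      rcases hclass t' ht' with
        ⟨b', hb', hbt', h'⟩ | ⟨-, h1', h2', h'⟩ | ⟨-, hE1', h1', h2', h', hlt'⟩ <;>
      rw [h, h'] at htt'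
    · have : b = b' := by omega
      rw [← hbt, ← hbt', this]
    all_goals first | omega | exact hφinj hE1 hE1' htt'
  · intro t ht t' ht' htt'
    rcases hcolor t ht with ⟨b, hb, rfl, h⟩ | ⟨htZ, h⟩ <;>
      rcases hcolor t' ht' with ⟨b', hb', rfl, h'⟩ | ⟨htZ', h'⟩ <;> rw [h, h']
    · have hne : b ≠ b' := fun h => by subst h; exact lt_irrefl _ htt'
      have h1 := hgapM _ (hcolW b) _ (hcolW b')
      rcases (hsep b hb b' hb' hne).2 htt' with h2 | ⟨h2, h3⟩
      · omega
      · have := hgap _ (hcolW b) _ (hcolW b') h2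
        omega
    · have := hgapM _ (hcolW b) _ hroot
      have := (hsepZ b hb t' htZ').2 htt'
      omega
    · have := hgapM _ hroot _ (hcolW b')
      have := (hsepZ b' hb' t htZ).1 htt'
      omega
    · rw [gap_self]; omega

end FloodGame

/-! ### Choice of the parameters and the final bounds -/

section Bounds

variable [PseudoMetricSpace V]

/-- Batches of `2 * κ * M` packets, `M` being the span cost of their colors `W`, such that serving
most of a batch requires about `M` transitions. -/
theorem exists_batch [DecidableEq V] {W : Finset V} (hW : W.Nonempty) (κ : ℕ) :
    ∃ r ∈ W, ∃ col : ℕ → V, (∀ y < 2 * κ * spanCost W, col y ∈ W) ∧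
      ∀ X ⊆ W, ∀ l, Spans X l → κ * spanCost W ≤
        κ * l + ((Finset.range (2 * κ * spanCost W)).filter fun y => col y ∉ X).card := by
  obtain ⟨r, hr, e, he, hext⟩ := (spans_spanCost hW).exists_charge
  set M := spanCost W with hM
  -- A color left out of `X` costs `κ` packets per unit of its connection charge, so `X` cannot be
  -- cheaper than completing it to `W`. The extra `κ * M` packets of color `r` penalize sets that
  -- avoid the root, for which the charges say nothing.
  let n : V → ℕ := fun v => κ * e v + if v = r then κ * M else 0
  have hn : ∑ v ∈ W, n v = 2 * κ * M := by
    simp only [n]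
    rw [Finset.sum_add_distrib, ← Finset.mul_sum, he, Finset.sum_ite_eq' W r, if_pos hr]
    ring
  obtain ⟨col, hcol, hcount⟩ := exists_coloring W n r
  rw [hn] at hcol hcount
  refine ⟨r, hr, col, hcol, fun X hX l hXl => ?_⟩
  have hfib : ((Finset.range (2 * κ * M)).filter fun y => col y ∉ X).card =
      ∑ v ∈ W \ X, n v := by
    rw [Finset.card_eq_sum_card_fiberwise (f := col) (t := W \ X)]
    · refine Finset.sum_congr rfl fun v hv => ?_
      rw [Finset.mem_sdiff] at hv
      rw [← hcount v hv.1, Finset.filter_filter]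
      congr 1
      refine Finset.filter_congr fun y _ => ?_
      exact ⟨fun h => h.2, fun h => ⟨h ▸ hv.2, h⟩⟩
    · intro y hy
      obtain ⟨hy, hyX⟩ := Finset.mem_filter.1 (Finset.mem_coe.1 hy)
      exact Finset.mem_coe.2 (Finset.mem_sdiff.2 ⟨hcol y (Finset.mem_range.1 hy), hyX⟩)
  rw [hfib]
  by_cases hrX : r ∈ X
  · have h1 := hext X l hXl hrX
    rw [Finset.union_eq_right.2 hX] at h1
    calc κ * M ≤ κ * (l + ∑ v ∈ W \ X, e v) := Nat.mul_le_mul_left _ (spanCost_le h1)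
      _ = κ * l + ∑ v ∈ W \ X, κ * e v := by rw [Nat.mul_add, Finset.mul_sum]
      _ ≤ κ * l + ∑ v ∈ W \ X, n v :=
          Nat.add_le_add_left (Finset.sum_le_sum fun v _ => Nat.le_add_right _ _) _
  · calc κ * M ≤ n r := by simp [n]
      _ ≤ ∑ v ∈ W \ X, n v :=
          Finset.single_le_sum (f := n) (fun _ _ => Nat.zero_le _)
            (Finset.mem_sdiff.2 ⟨hr, hrX⟩)
      _ ≤ _ := Nat.le_add_left _ _

/-- The bound given by a set of colors whose span cost is small compared to the laxity. -/
theorem ratio_le_of_spanCost [DecidableEq V] {W : Finset V} (hW : W.Nonempty) {κ L : ℕ}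
    (hM : 1 ≤ spanCost W) (hκ : 96 ≤ κ) (hL : 770 * κ ^ 2 * spanCost W ≤ L) :
    (∀ (A : OnlineAlgorithm V) (ρ : ℝ), AchievesRatio A.value L ρ →
        ρ ≤ 1 - κ * spanCost W / (32 * L)) ∧
      ∀ (Ω : Type*) [MeasurableSpace Ω] (R : RandomizedOnlineAlgorithm V Ω) (ρ : ℝ),
        AchievesRatio R.value L ρ → ρ ≤ 1 - κ * spanCost W / (32 * L) := by
  obtain ⟨r, hr, col, hcol, hcharge⟩ := exists_batch hW κ
  obtain ⟨x, hx, hgap⟩ := (spans_spanCost hW).exists_layout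
  set M := spanCost W with hMdef
  have hκM : 1 ≤ κ * M := Nat.mul_pos (by omega) hM
  have h6 : 96 * M ≤ κ * M := Nat.mul_le_mul_right _ hκ
  have hhor : 2 * κ * (192 * (2 * κ * M) + 6 * M) ≤ L := by
    refine le_trans ?_ hL
    calc 2 * κ * (192 * (2 * κ * M) + 6 * M) ≤ 2 * κ * (385 * (κ * M)) :=
          Nat.mul_le_mul_left _ (by rw [Nat.mul_assoc 2]; omega)
      _ = 770 * κ ^ 2 * M := by ring
  let G : FloodGame V :=
    { L := L
      T := 192 * (2 * κ * M) + 6 * M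
      N := 2 * κ * M
      m := 2 * κ
      root := r
      col := col
      batch_pos := by rw [Nat.mul_assoc]; omega
      batch_le := by omega
      horizon_le := hhor }
  have hH : G.H ≤ 4 * L := by
    have h1 : 2 * κ * (192 * (2 * κ * M) + 6 * M) ≥ 1 :=
      Nat.mul_pos (by omega) (by rw [Nat.mul_assoc 2]; omega)
    change 2 * (2 * κ * (192 * (2 * κ * M) + 6 * M)) + L + 1 ≤ 4 * L
    omega
  have hLH : L ≤ G.H := by
    change L ≤ 2 * (2 * κ * (192 * (2 * κ * M) + 6 * M)) + L + 1
    omega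
  have hκML : κ * M ≤ L := by
    have : κ * M ≤ 770 * κ ^ 2 * M :=
      Nat.mul_le_mul_right _ (by nlinarith)
    omega
  -- With one tour per `192` periods, the tours cost at most `6 * M * (2 * κ / 192) = κ * M / 16`,
  -- plus `6 * M ≤ κ * M / 16` for one more tour because `96 ≤ κ`. The total `κ * M / 8` is half of
  -- the average loss of an algorithm.
  have hopt : ∀ k ∈ Finset.range (2 * κ), 8 * G.H ≤ 8 * opt (G.seq (k + 1)) + κ * M := by
    intro k hk
    rw [Finset.mem_range] at hk
    have h1 : G.H ≤ opt (G.seq (k + 1)) + 6 * M * ((k + 1 - 1) / 192 + 1) :=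
      G.le_opt_seq (K := 192) (by norm_num) le_rfl (show k + 1 ≤ 2 * κ from hk) hr hcol hx hgap
    rw [Nat.add_sub_cancel] at h1
    have h2 : M * (192 * (k / 192)) ≤ M * (2 * κ) :=
      Nat.mul_le_mul_left _ ((Nat.mul_div_le _ _).trans hk.le)
    have h3 : M * (192 * (k / 192)) = 192 * (M * (k / 192)) := by ring
    have h4 : 6 * M * (k / 192 + 1) = 6 * (M * (k / 192)) + 6 * M := by ring
    have h5 : M * (2 * κ) = 2 * (κ * M) := by ring
    omega
  have hval : ∀ A : OnlineAlgorithm V,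
      2 * ∑ k ∈ Finset.range (2 * κ), throughput (G.seq (k + 1)) (A.schedule (G.seq (k + 1))) +
        κ * (κ * M) ≤ 2 * (2 * κ * G.H) := fun A =>
    G.sum_throughput_le A rfl fun k hk =>
      G.charge_le A hr hcol
        (show κ * M ≤ 2 * κ * M from Nat.mul_le_mul_right _ (by omega)) hcharge hk
  have hL0 : (0 : ℝ) < L := by exact_mod_cast (show 0 < L by omega)
  have hκ0 : (0 : ℝ) < κ := by exact_mod_cast (show 0 < κ by omega)
  have hH' : (G.H : ℝ) ≤ 4 * L := by exact_mod_cast hH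
  have hLH' : (L : ℝ) ≤ G.H := by exact_mod_cast hLH
  have hκML' : (κ * M : ℝ) ≤ L := by exact_mod_cast hκML
  have hκM' : (1 : ℝ) ≤ κ * M := by exact_mod_cast hκM
  have hsum : 2 * κ * ((G.H : ℝ) - κ * M / 8) ≤
      ∑ k ∈ Finset.range (2 * κ), (opt (G.seq (k + 1)) : ℝ) := by
    have h1 : ∀ k ∈ Finset.range (2 * κ), (G.H : ℝ) - κ * M / 8 ≤ opt (G.seq (k + 1)) := by
      intro k hk
      have : (8 * G.H : ℝ) ≤ 8 * opt (G.seq (k + 1)) + κ * M := by exact_mod_cast hopt k hk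
      linarith
    have h2 := Finset.card_nsmul_le_sum _ _ _ h1
    rw [Finset.card_range, nsmul_eq_mul] at h2
    push_cast at h2
    exact h2
  refine ratio_le_of_family (Finset.range (2 * κ)) (fun k => G.seq (k + 1))
    (fun k hk => G.seq_hasMinLaxity (Finset.mem_range.1 hk)) ?_ fun A => ?_
  · refine lt_of_lt_of_le ?_ hsum
    have : (0 : ℝ) < G.H - κ * M / 8 := by linarith
    positivity
  · have hβ : (0 : ℝ) ≤ 1 - κ * M / (32 * L) := by
      rw [sub_nonneg, div_le_one (by positivity)]
      linarith
    refine le_trans ?_ (mul_le_mul_of_nonneg_left hsum hβ)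
    have h1 : 2 * ∑ k ∈ Finset.range (2 * κ), A.value (G.seq (k + 1)) + κ * (κ * M) ≤
        2 * (2 * κ * G.H) := by
      simp only [OnlineAlgorithm.value]
      exact_mod_cast hval A
    have h2 : (κ * M / (32 * L) : ℝ) * G.H ≤ κ * M / 8 := by
      rw [div_mul_eq_mul_div, div_le_div_iff₀ (by positivity) (by norm_num)]
      nlinarith
    have h3 : (0 : ℝ) ≤ κ * M / (32 * L) * (κ * M / 8) := by positivity
    nlinarith

/-- Needed when all colors are at distance `0`: the claim is then only `ρ ≤ 1`, which still requires
one sequence with a positive optimum. -/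
theorem ratio_le_one {L : ℕ} [Nonempty V] (hL : 1 ≤ L) :
    (∀ (A : OnlineAlgorithm V) (ρ : ℝ), AchievesRatio A.value L ρ → ρ ≤ 1) ∧
      ∀ (Ω : Type*) [MeasurableSpace Ω] (R : RandomizedOnlineAlgorithm V Ω) (ρ : ℝ),
        AchievesRatio R.value L ρ → ρ ≤ 1 := by
  obtain ⟨v⟩ := ‹Nonempty V›
  refine ratio_le_of_family {true} (duelSeq v v L) (fun b _ => duelSeq_hasMinLaxity v v L b) ?_
    fun A => ?_
  · have := le_opt_duelSeq v v L true
    rw [Finset.sum_singleton]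
    exact_mod_cast (show 0 < opt (duelSeq v v L true) by omega)
  · rw [one_mul]
    exact Finset.sum_le_sum fun b _ => throughput_le_opt A _

/-- The upper bound of the competitive ratio for both regimes of `delta`. -/
theorem ratio_le [Fintype V] [Nonempty V] {L : ℕ} (hL : 1 ≤ L) :
    (∀ (A : OnlineAlgorithm V) (ρ : ℝ), AchievesRatio A.value L ρ →
        ρ ≤ 1 - 10⁻¹ ^ 9 * min 1 (Real.sqrt (delta V L))) ∧
      ∀ (Ω : Type*) [MeasurableSpace Ω] (R : RandomizedOnlineAlgorithm V Ω) (ρ : ℝ),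
        AchievesRatio R.value L ρ → ρ ≤ 1 - 10⁻¹ ^ 9 * min 1 (Real.sqrt (delta V L)) := by
  classical
  have hL0 : (0 : ℝ) < L := by exact_mod_cast hL
  have hmst : mst V ≤ spanCost (Finset.univ : Finset V) :=
    mst_le_of_spans (spans_spanCost Finset.univ_nonempty)
  by_cases hzero : spanCost (Finset.univ : Finset V) = 0
  · rw [hzero, Nat.cast_zero] at hmst
    have : Real.sqrt (delta V L) = 0 :=
      Real.sqrt_eq_zero_of_nonpos (div_nonpos_of_nonpos_of_nonneg hmst hL0.le)
    rw [this, min_eq_right zero_le_one, mul_zero, sub_zero]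
    exact ratio_le_one hL
  by_cases hbig : ∃ u v : V, L + 1 ≤ 30000000 * gap u v
  · obtain ⟨u, v, huv⟩ := hbig
    have h := ratio_le_of_gap (by norm_num) huv
    have hle : 1 - 1 / (4 * ((30000000 : ℕ) : ℝ)) ≤
        1 - 10⁻¹ ^ 9 * min 1 (Real.sqrt (delta V L)) := by
      have := min_le_left 1 (Real.sqrt (delta V L))
      push_cast
      linarith
    exact ⟨fun A ρ hρ => (h.1 A ρ hρ).trans hle, fun Ω _ R ρ hρ => (h.2 Ω R ρ hρ).trans hle⟩
  push Not at hbig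
  have hD : ∀ u v : V, gap u v ≤ L / 30000000 := fun u v =>
    (Nat.le_div_iff_mul_le (by norm_num)).2 (by have := hbig u v; omega)
  obtain ⟨W, hW, h1, h2⟩ := exists_spanCost_between (θ := L / 30000000) hD
    (Finset.univ_nonempty (α := V))
  set M := spanCost W with hM
  -- Otherwise all gaps vanish, and with them the span cost.
  have hL' : 1 ≤ L / 30000000 := by
    by_contra hc
    have h := (spans_spanCost (Finset.univ_nonempty (α := V))).le_card_mul hD
    rw [show L / 30000000 = 0 by omega, Nat.mul_zero] at h
    omega
  have hM1 : 1 ≤ M := by omega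
  -- The largest `κ` for which all periods fit into `L` slots by the estimate of
  -- `ratio_le_of_spanCost`. As `M ≤ 2 * (L / 30000000)`, it is at least `96`. The factor `3080 = 4
  -- * 770` below comes from `κ + 1 ≤ 2 * κ`.
  set κ := Nat.sqrt (L / (770 * M)) with hκdef
  have hκ : 96 ≤ κ := Nat.le_sqrt.2 ((Nat.le_div_iff_mul_le (by omega)).2 (by omega))
  have hκL : 770 * κ ^ 2 * M ≤ L := by
    have h : κ * κ * (770 * M) ≤ L :=
      (Nat.mul_le_mul_right _ (Nat.sqrt_le _)).trans (Nat.div_mul_le_self _ _)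
    calc 770 * κ ^ 2 * M = κ * κ * (770 * M) := by ring
      _ ≤ L := h
  have hLκ : L ≤ 3080 * κ ^ 2 * M := by
    have h : L < (κ + 1) * (κ + 1) * (770 * M) :=
      (Nat.div_lt_iff_lt_mul (by omega)).1 (Nat.sqrt_lt.1 (Nat.lt_succ_self _))
    calc L ≤ (κ + 1) * (κ + 1) * (770 * M) := h.le
      _ ≤ (2 * κ) * (2 * κ) * (770 * M) :=
          Nat.mul_le_mul_right _ (Nat.mul_le_mul (by omega) (by omega))
      _ = 3080 * κ ^ 2 * M := by ring
  have h := ratio_le_of_spanCost hW hM1 hκ hκL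
  set t := min 1 (Real.sqrt (delta V L)) with ht
  have ht0 : 0 ≤ t := le_min zero_le_one (Real.sqrt_nonneg _)
  have ht1 : t ≤ 1 := min_le_left _ _
  have hM0 : (1 : ℝ) ≤ M := by exact_mod_cast hM1
  -- Either `M` is at least the span cost of all colors, so `delta V L ≤ M / L`, or `M ≥ L /
  -- 30000000` as a rounded quotient. In the latter case `t ≤ 1` suffices, the rounding costing at
  -- most a factor `2`.
  have htM : t ^ 2 * L ≤ 60000000 * M := by
    rcases le_total (spanCost (Finset.univ : Finset V)) (L / 30000000) with hc | hc
    · have hδ : delta V L ≤ M / L := by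
        refine div_le_div_of_nonneg_right (hmst.trans ?_) hL0.le
        exact_mod_cast (show spanCost (Finset.univ : Finset V) ≤ M by omega)
      have htδ : t ≤ Real.sqrt (M / L) := (min_le_right _ _).trans (Real.sqrt_le_sqrt hδ)
      have h3 : t ^ 2 ≤ M / L := (Real.le_sqrt ht0 (by positivity)).1 htδ
      rw [le_div_iff₀ hL0] at h3
      linarith
    · have hLM : (L : ℝ) ≤ 60000000 * M := by exact_mod_cast (show L ≤ 60000000 * M by omega)
      have : t ^ 2 ≤ 1 := pow_le_one₀ ht0 ht1
      nlinarith
  have hLκ' : (L : ℝ) ≤ 3080 * κ ^ 2 * M := by exact_mod_cast hLκ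
  have hle : 10⁻¹ ^ 9 * t ≤ κ * M / (32 * L) := by
    rw [le_div_iff₀ (by positivity)]
    refine le_of_sq_le_sq ?_ (by positivity)
    have h4 : t ^ 2 * L * L ≤ 60000000 * M * (3080 * κ ^ 2 * M) :=
      mul_le_mul htM hLκ' hL0.le (by positivity)
    have h5 : (0 : ℝ) ≤ (κ * M) ^ 2 := by positivity
    nlinarith
  exact ⟨fun A ρ hρ => (h.1 A ρ hρ).trans (by linarith),
    fun Ω _ R ρ hρ => (h.2 Ω R ρ hρ).trans (by linarith)⟩

end Bounds

end ColoredPackets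

end

theorem mainTheorem1 :
    ∃ c α : ℝ, 0 < c ∧ α < 1 ∧
      ∀ (V : Type u) [Fintype V] [Nonempty V] [PseudoMetricSpace V] (L : ℕ), 1 ≤ L →
        (ColoredPackets.delta V L < 1 →
          (∀ (A : ColoredPackets.OnlineAlgorithm V) (ρ : ℝ),
            ColoredPackets.AchievesRatio A.value L ρ →
              ρ ≤ 1 - c * Real.sqrt (ColoredPackets.delta V L)) ∧
          (∀ (Ω : Type v) [MeasurableSpace Ω]
            (R : ColoredPackets.RandomizedOnlineAlgorithm V Ω) (ρ : ℝ),
            ColoredPackets.AchievesRatio R.value L ρ →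
              ρ ≤ 1 - c * Real.sqrt (ColoredPackets.delta V L))) ∧
        (1 ≤ ColoredPackets.delta V L →
          (∀ (A : ColoredPackets.OnlineAlgorithm V) (ρ : ℝ),
            ColoredPackets.AchievesRatio A.value L ρ → ρ ≤ α) ∧
          (∀ (Ω : Type v) [MeasurableSpace Ω]
            (R : ColoredPackets.RandomizedOnlineAlgorithm V Ω) (ρ : ℝ),
            ColoredPackets.AchievesRatio R.value L ρ → ρ ≤ α)) := by
  refine ⟨10⁻¹ ^ 9, 1 - 10⁻¹ ^ 9, by positivity, by norm_num, ?_⟩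
  intro V _ _ _ L hL
  have h := ColoredPackets.ratio_le (V := V) hL
  refine ⟨fun hδ => ?_, fun hδ => ?_⟩
  · rw [min_eq_right (Real.sqrt_le_one.2 hδ.le)] at h
    exact h
  · rw [min_eq_left (Real.one_le_sqrt.2 hδ), mul_one] at h
    exact h
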